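/- Let $n\ge 1$ and let $(M,\Omega,\theta)$ be a locally conformal symplectic (LCS) manifold of dimension $2n$: $M$ is a smooth Hausdorff manifold, $\Omega$ is a smooth nondegenerate 2-form and $\theta$ a smooth closed 1-form with $d\Omega=\theta\wedge\Omega$. For a smooth function $f$ and a closed 1-form $\eta$ write $d^{\eta}f=df-f\eta$. Let $H\in C^\infty(M)$ and let $X_H$ be the Hamiltonian vector field of $H$, defined by $X_H\lrcorner\,\Omega=d^{\theta}H$. A *scaling symmetry of degree* $\Lambda\in\mathbb R$ of $(M,\Omega,\theta,H)$ is a smooth vector field $X$ with $L_X\Omega=\Omega$, $L_X\theta=0$ and $L_XH=\Lambda H$. A (local) transformation $\Psi$ of $M$, i.e. a smooth diffeomorphism from an open subset of $M$ onto an open subset of $M$, is called *canonical* if $\Psi^*\Omega=\Omega$ on its domain, and *canonoid* for $(M,\Omega,\theta,H)$ if there is a smooth function $K$ on its domain with $X_H\lrcorner\,\Psi^*\Omega=d^{\Psi^*\theta}K$. Let $X$ be a scaling symmetry of degree $\Lambda$ of $(M,\Omega,\theta,H)$. Then $X$ is the infinitesimal generator of a (local) one-parameter group of transformations $\{\Phi_s\}_{s\in\mathbb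 R}$ of $M$ (its flow, $\Phi_s$ being defined on the open set of points whose integral curve exists up to time $s$), and for every such (local) one-parameter group with generator $X$: 1. each $\Phi_s$ is a canonoid transformation for $(M,\Omega,\theta,H)$; 2. for each $s\neq 0$ for which the domain of $\Phi_s$ is nonempty, $\Phi_s$ is not canonical; 3. if $X$ is complete, then every $\Phi_s$ is a diffeomorphism of $M$ onto $M$, so that $\{\Phi_s\}$ is a one-parameter group of canonoid transformations of $M$ in the global sense. -/

import Mathlib

open Set
open scoped Manifold ContDiff

noncomputable section

/-- The model vector space `ℝ^m`. -/
abbrev EucSp (m : ℕ) : Type := EuclideanSpace ℝ (Fin m)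

section Forms

variable {m : ℕ} {M : Type*} [TopologicalSpace M] [ChartedSpace (EucSp m) M]

/-- A (not necessarily smooth) differential `k`-form on the `m`-dimensional manifold `M`. -/
abbrev DiffForm (m : ℕ) (M : Type*) [TopologicalSpace M] [ChartedSpace (EucSp m) M]
    (k : ℕ) : Type _ :=
  (p : M) → (TangentSpace (𝓡 m) p) [⋀^Fin k]→L[ℝ] ℝ

/-- A (not necessarily smooth) vector field on `M`. -/
abbrev VecField (m : ℕ) (M : Type*) [TopologicalSpace M] [ChartedSpace (EucSp m) M] : Type _ :=
  (p : M) → TangentSpace (𝓡 m) p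

/-- Smoothness of a vector field, as a section of the tangent bundle. -/
def IsSmoothVecField [IsManifold (𝓡 m) ∞ M] (X : VecField m M) : Prop :=
  ContMDiff (𝓡 m) (𝓡 m).tangent ∞ (fun p => (⟨p, X p⟩ : TangentBundle (𝓡 m) M))

/-- The pullback `f^* α`: `(f^* α)_p (v₁, …, v_k) = α_{f p} (df_p v₁, …, df_p v_k)`. -/
def DiffForm.pullback {k : ℕ} (f : M → M) (α : DiffForm m M k) : DiffForm m M k :=
  fun p => (α (f p)).compContinuousLinearMap (mfderiv (𝓡 m) (𝓡 m) f p)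

/-- The expression of `α` in the preferred chart `φ` at `x`, i.e. `(φ⁻¹)^* α`, a form on
the open set `(extChartAt (𝓡 m) x).target ⊆ ℝ^m`. -/
def DiffForm.chartRep {k : ℕ} (α : DiffForm m M k) (x : M) :
    EucSp m → (EucSp m) [⋀^Fin k]→L[ℝ] ℝ :=
  fun y => (α ((extChartAt (𝓡 m) x).symm y)).compContinuousLinearMap
    (mfderiv 𝓘(ℝ, EucSp m) (𝓡 m) (extChartAt (𝓡 m) x).symm y)

/-- A form is smooth if its expressions in charts covering `M` are smooth. -/
def DiffForm.IsSmooth {k : ℕ} (α : DiffForm m M k) : Prop :=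
  ∀ x : M, ContDiffOn ℝ ∞ (α.chartRep x) (extChartAt (𝓡 m) x).target

/-- The exterior derivative: in a chart around `p` it is the exterior derivative of the
expression of the form in that chart. -/
def DiffForm.d {k : ℕ} (α : DiffForm m M k) : DiffForm m M (k + 1) :=
  fun p => (extDeriv (α.chartRep p) (extChartAt (𝓡 m) p p)).compContinuousLinearMap
    (mfderiv (𝓡 m) 𝓘(ℝ, EucSp m) (extChartAt (𝓡 m) p) p)

/-- The interior product: `(X ⌟ α)_p (v₁, …, v_k) = α_p (X_p, v₁, …, v_k)`. -/
def DiffForm.interior {k : ℕ} (X : VecField m M) (α : DiffForm m M (k + 1)) : DiffForm m M k :=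
  fun p => ContinuousAlternatingMap.curryLeft (E := EucSp m) (α p) (X p)

/-- The Lie derivative of a form of positive degree along a vector field,
`L_X α = d (X ⌟ α) + X ⌟ dα`. -/
def DiffForm.lieDeriv {k : ℕ} (X : VecField m M) (α : DiffForm m M (k + 1)) :
    DiffForm m M (k + 1) :=
  (α.interior X).d + α.d.interior X

/-- The differential `df_p : T_p M → ℝ` of a function. -/
def diffFun (m : ℕ) {M : Type*} [TopologicalSpace M] [ChartedSpace (EucSp m) M]
    (f : M → ℝ) (p : M) : TangentSpace (𝓡 m) p →L[ℝ] ℝ :=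
  mfderiv (𝓡 m) 𝓘(ℝ, ℝ) f p

/-- The Lie derivative `L_X f = df(X)` of a function along a vector field. -/
def lieDerivFun (X : VecField m M) (f : M → ℝ) : M → ℝ :=
  fun p => diffFun m f p (X p)

/-- The twisted differential `d^θ f = df - f θ` of a function, at `p`, as a linear form on
`T_p M`. -/
def twistedDiff (θ : DiffForm m M 1) (f : M → ℝ) (p : M) :
    Module.Dual ℝ (TangentSpace (𝓡 m) p) where
  toFun v := diffFun m f p v - f p * θ p ![v]
  map_add' u v := by
    have h := (θ p).map_update_add ![0] 0 u v
    have e : ∀ w : TangentSpace (𝓡 m) p, Function.update ![0] 0 w = ![w] := by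
      intro w; ext i; fin_cases i; rfl
    simp only [e] at h
    rw [h, map_add]
    ring
  map_smul' c v := by
    have h := (θ p).map_update_smul ![0] 0 c v
    have e : ∀ w : TangentSpace (𝓡 m) p, Function.update ![0] 0 w = ![w] := by
      intro w; ext i; fin_cases i; rfl
    simp only [e] at h
    rw [h, map_smul]
    simp only [smul_eq_mul, RingHom.id_apply]
    ring

end Forms

/-- A locally conformal symplectic structure on a `2n`-dimensional manifold `M`: a smooth
nondegenerate 2-form `Ω` and a smooth closed 1-form `θ` with `dΩ = θ ∧ Ω`. -/
structure LCSStructure (n : ℕ) (M : Type*) [TopologicalSpace M]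
    [ChartedSpace (EucSp (2 * n)) M] where
  Ω : DiffForm (2 * n) M 2
  θ : DiffForm (2 * n) M 1
  smooth_Ω : Ω.IsSmooth
  smooth_θ : θ.IsSmooth
  nondegenerate : ∀ (p : M) (u : TangentSpace (𝓡 (2 * n)) p),
    (∀ v : TangentSpace (𝓡 (2 * n)) p, Ω p ![u, v] = 0) → u = 0
  closed_θ : θ.d = 0
  d_Ω : ∀ (p : M) (u v w : TangentSpace (𝓡 (2 * n)) p),
    Ω.d p ![u, v, w] =
      θ p ![u] * Ω p ![v, w] - θ p ![v] * Ω p ![u, w] + θ p ![w] * Ω p ![u, v]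

section LCS

variable {n : ℕ} {M : Type*} [TopologicalSpace M] [ChartedSpace (EucSp (2 * n)) M]

/-- The linear map `u ↦ u ⌟ Ω` from `T_p M` to its dual. -/
def LCSStructure.flat (S : LCSStructure n M) (p : M) :
    TangentSpace (𝓡 (2 * n)) p →ₗ[ℝ] Module.Dual ℝ (TangentSpace (𝓡 (2 * n)) p) :=
  have e₀ : ∀ w v : TangentSpace (𝓡 (2 * n)) p, Function.update ![0, v] 0 w = ![w, v] := by
    intro w v; ext i; fin_cases i <;> rfl
  have e₁ : ∀ w u : TangentSpace (𝓡 (2 * n)) p, Function.update ![u, 0] 1 w = ![u, w] := by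
    intro w u; ext i; fin_cases i <;> rfl
  LinearMap.mk₂ ℝ (fun u v => S.Ω p ![u, v])
    (fun u u' v => by
      have h := (S.Ω p).map_update_add ![0, v] 0 u u'
      simpa only [e₀] using h)
    (fun c u v => by
      have h := (S.Ω p).map_update_smul ![0, v] 0 c u
      simpa only [e₀] using h)
    (fun u v v' => by
      have h := (S.Ω p).map_update_add ![u, 0] 1 v v'
      simpa only [e₁] using h)
    (fun c u v => by
      have h := (S.Ω p).map_update_smul ![u, 0] 1 c v
      simpa only [e₁] using h)

theorem LCSStructure.flat_injective (S : LCSStructure n M) (p : M) :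
    Function.Injective (S.flat p) := by
  rw [injective_iff_map_eq_zero]
  intro u hu
  exact S.nondegenerate p u (fun v => LinearMap.congr_fun hu v)

/-- The musical isomorphism `T_p M ≃ T_p^* M`, `u ↦ u ⌟ Ω`. -/
def LCSStructure.flatEquiv (S : LCSStructure n M) (p : M) :
    TangentSpace (𝓡 (2 * n)) p ≃ₗ[ℝ] Module.Dual ℝ (TangentSpace (𝓡 (2 * n)) p) :=
  haveI : FiniteDimensional ℝ (TangentSpace (𝓡 (2 * n)) p) :=
    inferInstanceAs (FiniteDimensional ℝ (EucSp (2 * n)))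
  LinearEquiv.ofInjectiveOfFinrankEq (S.flat p) (S.flat_injective p)
    (Subspace.dual_finrank_eq).symm

/-- The Hamiltonian vector field `X_H` of `H`, defined by `X_H ⌟ Ω = d^θ H`. -/
def LCSStructure.hamVF (S : LCSStructure n M) (H : M → ℝ) : VecField (2 * n) M :=
  fun p => (S.flatEquiv p).symm (twistedDiff S.θ H p)

theorem LCSStructure.hamVF_spec (S : LCSStructure n M) (H : M → ℝ) (p : M)
    (v : TangentSpace (𝓡 (2 * n)) p) :
    S.Ω p ![S.hamVF H p, v] = diffFun (2 * n) H p v - H p * S.θ p ![v] := by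
  have h : S.flatEquiv p (S.hamVF H p) = twistedDiff S.θ H p :=
    (S.flatEquiv p).apply_symm_apply _
  exact LinearMap.congr_fun h v

/-- `X` is a scaling symmetry of degree `Λ` of the Hamiltonian system `(M, Ω, θ, H)`:
`L_X Ω = Ω`, `L_X θ = 0` and `L_X H = Λ H`. -/
structure LCSStructure.IsScalingSymmetry [IsManifold (𝓡 (2 * n)) ∞ M] (S : LCSStructure n M) (H : M → ℝ) (Λ : ℝ)
    (X : VecField (2 * n) M) : Prop where
  smooth : IsSmoothVecField X
  lie_Ω : S.Ω.lieDeriv X = S.Ω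
  lie_θ : S.θ.lieDeriv X = 0
  lie_H : ∀ p, lieDerivFun X H p = Λ * H p

/-- A (local) transformation of `M`: a smooth diffeomorphism from an open subset (the source)
onto an open subset (the target). A diffeomorphism of `M` is the case where both are all of `M`. -/
def IsTransformation (m : ℕ) {M : Type*} [TopologicalSpace M] [ChartedSpace (EucSp m) M]
    (Ψ : OpenPartialHomeomorph M M) : Prop :=
  ContMDiffOn (𝓡 m) (𝓡 m) ∞ Ψ Ψ.source ∧ ContMDiffOn (𝓡 m) (𝓡 m) ∞ Ψ.symm Ψ.target

/-- A (strictly) canonical (local) transformation: `Ψ^* Ω = Ω` wherever `Ψ` is defined. -/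
def LCSStructure.IsCanonical (S : LCSStructure n M) (Ψ : OpenPartialHomeomorph M M) : Prop :=
  IsTransformation (2 * n) Ψ ∧ ∀ p ∈ Ψ.source, S.Ω.pullback Ψ p = S.Ω p

/-- A canonoid (local) transformation for `(M, Ω, θ, H)`: there is a smooth function `K` with
`X_H ⌟ Ψ^* Ω = d^{Ψ^* θ} K` wherever `Ψ` is defined. -/
def LCSStructure.IsCanonoid (S : LCSStructure n M) (H : M → ℝ)
    (Ψ : OpenPartialHomeomorph M M) : Prop :=
  IsTransformation (2 * n) Ψ ∧
    ∃ K : M → ℝ, ContMDiffOn (𝓡 (2 * n)) 𝓘(ℝ, ℝ) ∞ K Ψ.source ∧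
      ∀ p ∈ Ψ.source, ∀ v : TangentSpace (𝓡 (2 * n)) p,
        S.Ω.pullback Ψ p ![S.hamVF H p, v] = twistedDiff (S.θ.pullback Ψ) K p v

end LCS

/-- A smooth local one-parameter group of transformations (a local flow) on `M`, with its natural
domain: `Φ 0 = id`, the set of `(s, p)` with `Φ s p` defined is open in `ℝ × M` and `(s, p) ↦ Φ s p`
is smooth there, for each `p` the set of admissible `s` is an interval, and
`Φ t (Φ s p) = Φ (s + t) p`, the left side being defined exactly when the right side is
(whenever `Φ s p` is). If all `Φ s` are defined on all of `M` this is a one-parameter group of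
diffeomorphisms of `M`. -/
structure LocalOneParamGroup (m : ℕ) (M : Type*) [TopologicalSpace M]
    [ChartedSpace (EucSp m) M] where
  toFun : ℝ → OpenPartialHomeomorph M M
  source_zero : (toFun 0).source = univ
  map_zero : ∀ p, toFun 0 p = p
  isOpen_domain : IsOpen {z : ℝ × M | z.2 ∈ (toFun z.1).source}
  smooth : ContMDiffOn (𝓘(ℝ, ℝ).prod (𝓡 m)) (𝓡 m) ∞ (fun z : ℝ × M => toFun z.1 z.2)
    {z : ℝ × M | z.2 ∈ (toFun z.1).source}
  ordConnected : ∀ p, {s : ℝ | p ∈ (toFun s).source}.OrdConnected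
  mem_source_iff : ∀ s t p, p ∈ (toFun s).source →
    (toFun s p ∈ (toFun t).source ↔ p ∈ (toFun (s + t)).source)
  map_add : ∀ s t p, p ∈ (toFun s).source → p ∈ (toFun (s + t)).source →
    toFun t (toFun s p) = toFun (s + t) p

/-- `X` is the infinitesimal generator of `Φ`: `d/ds Φ s p = X_p` at `s = 0`
(recall `Φ 0 p = p`). -/
def LocalOneParamGroup.IsGeneratedBy {m : ℕ} {M : Type*} [TopologicalSpace M]
    [ChartedSpace (EucSp m) M] (Φ : LocalOneParamGroup m M) (X : VecField m M) : Prop :=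
  ∀ p : M, HasMFDerivAt 𝓘(ℝ, ℝ) (𝓡 m) (fun s : ℝ => Φ.toFun s p) 0
    ((1 : ℝ →L[ℝ] ℝ).smulRight (X (Φ.toFun 0 p)))

/-- `X` is complete: through every point passes an integral curve defined on all of `ℝ`. -/
def IsCompleteVecField {m : ℕ} {M : Type*} [TopologicalSpace M]
    [ChartedSpace (EucSp m) M] (X : VecField m M) : Prop :=
  ∀ p : M, ∃ γ : ℝ → M, γ 0 = p ∧ IsMIntegralCurve (I := 𝓡 m) γ X

end

/-! Along a flow with generator X one has d/dt Φ_t^*α = Φ_t^*(L_X α). If L_X α = cα, then e^{-ct}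
Φ_t^*α is constant on the interval of times at which the flow is defined at the given point, so
Φ_s^*α = e^{cs} α (`LocalOneParamGroup.IsGeneratedBy.pullback_eq_exp_smul`). For a scaling symmetry
this gives Φ_s^*Ω = e^s Ω and Φ_s^*θ = θ. Hence X_H ⌟ Φ_s^*Ω = e^s d^θ H = d^{Φ_s^*θ}(e^s H), and K
= e^s H shows that Φ_s is canonoid. If Φ_s were canonical with s ≠ 0, then Ω would vanish at a
point, against nondegeneracy in dimension 2n > 0.

Two analytic facts carry the rest. First, L_X is defined by d(X ⌟ α) + X ⌟ dα, so the derivative of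
the pullback has to be identified with it: in a chart at time 0 by `hasDerivAt_flow_pullback` and
`extDeriv_curryLeft_add`, at other times by the group law. Second, a smooth field has a smooth local
flow: the integral equation is solved by the inverse function theorem in a space of curves
(`exists_contDiffOn_localFlow`), carried to M by charts, and extended to the maximal domain by
uniqueness of integral curves and connectedness of time intervals. For complete X, the admissible
times of a point form a nonempty clopen subset of ℝ. -/

noncomputable section

universe u

/-! ### Smooth local flows of differential equations in a Banach space -/

section LocalFlow

open Metric Filter Topology Uniformity

/-- Pointwise application of a continuous family of operators to a continuous curve. -/
def ContinuousMap.pointwiseApply (K E F : Type*) [TopologicalSpace K] [CompactSpace K]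
    [NormedAddCommGroup E] [NormedSpace ℝ E] [NormedAddCommGroup F] [NormedSpace ℝ F] :
    C(K, E →L[ℝ] F) →L[ℝ] C(K, E) →L[ℝ] C(K, F) :=
  LinearMap.mkContinuous₂
    (LinearMap.mk₂ ℝ (fun (A : C(K, E →L[ℝ] F)) (h : C(K, E)) =>
      (⟨fun t => A t (h t), A.continuous.clm_apply h.continuous⟩ : C(K, F)))
      (fun A B h => by ext t; simp) (fun c A h => by ext t; simp)
      (fun A h k => by ext t; simp) (fun c A h => by ext t; simp)) 1
    (fun A h => by
      rw [ContinuousMap.norm_le _ (by positivity), one_mul]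
      intro t
      exact ((A t).le_opNorm _).trans
        (mul_le_mul (A.norm_coe_le_norm t) (h.norm_coe_le_norm t) (norm_nonneg _) (by positivity)))

/-- The image of `u` is compact, so one radius δ controls the variation of `f'` around every point
`u t`. The mean value inequality then bounds the remainder by `c * ‖h t‖` for all `t` at once. -/
theorem hasFDerivAt_postcomp {K E F : Type*} [TopologicalSpace K] [CompactSpace K]
    [NormedAddCommGroup E] [NormedSpace ℝ E] [NormedAddCommGroup F] [NormedSpace ℝ F]
    {f : E → F} {f' : E → E →L[ℝ] F} (hf : ∀ x, HasFDerivAt f (f' x) x) (hf' : Continuous f')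
    (u : C(K, E)) :
    HasFDerivAt (fun u : C(K, E) =>
        (⟨fun t => f (u t), (continuous_iff_continuousAt.2 fun x => (hf x).continuousAt).comp
          u.continuous⟩ : C(K, F)))
      (ContinuousMap.pointwiseApply K E F ⟨fun t => f' (u t), hf'.comp u.continuous⟩) u := by
  rw [hasFDerivAt_iff_isLittleO_nhds_zero, Asymptotics.isLittleO_iff]
  intro c hc
  have hcomp : IsCompact (range u) := isCompact_range u.continuous
  have hev : ∀ᶠ p in 𝓤 E, p.1 ∈ range u → (f' p.1, f' p.2) ∈ {q | dist q.1 q.2 < c} := by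
    have := hcomp.uniformContinuousAt_of_continuousAt f' (fun x _ => hf'.continuousAt)
      (Metric.dist_mem_uniformity hc)
    exact this
  obtain ⟨δ, hδ, hev⟩ := Metric.mem_uniformity_dist.1 hev
  filter_upwards [Metric.ball_mem_nhds (0 : C(K, E)) hδ] with h hh
  rw [ContinuousMap.norm_le _ (by positivity)]
  intro t
  have hht : ‖h t‖ < δ := (h.norm_coe_le_norm t).trans_lt (by simpa using hh)
  have key := (convex_ball (u t) δ).norm_image_sub_le_of_norm_hasFDerivWithin_le'
    (f := f) (f' := f') (φ := f' (u t)) (C := c) (x := u t) (y := u t + h t)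
    (fun x _ => (hf x).hasFDerivWithinAt)
    (fun x hx => by
      have := hev (a := u t) (b := x) (by rw [dist_comm]; exact hx) (mem_range_self t)
      rw [mem_ofPred_eq, dist_comm, dist_eq_norm] at this
      exact this.le)
    (mem_ball_self hδ) (by simpa [mem_ball, dist_eq_norm] using hht)
  have e : u t + h t - u t = h t := by abel
  rw [e] at key
  exact key.trans (mul_le_mul_of_nonneg_left (h.norm_coe_le_norm t) hc.le)

/-- The derivative is postcomposition with `f'` followed by a fixed continuous linear map, so
induction on the order applies. The target `F` varies in the induction because it becomes `E →L[ℝ]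
F`, which is why both spaces share a universe. -/
theorem contDiff_postcomp_nat {K : Type*} {E : Type u} [TopologicalSpace K] [CompactSpace K]
    [NormedAddCommGroup E] [NormedSpace ℝ E] (n : ℕ) :
    ∀ {F : Type u} [NormedAddCommGroup F] [NormedSpace ℝ F] {f : E → F} (hf : ContDiff ℝ n f),
    ContDiff ℝ n (fun u : C(K, E) => (⟨fun t => f (u t), hf.continuous.comp u.continuous⟩ : C(K, F)))
    := by
  induction n with
  | zero =>
    intro F _ _ f hf
    exact contDiff_zero.2 (ContinuousMap.continuous_postcomp ⟨f, hf.continuous⟩)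
  | succ n ih =>
    intro F _ _ f hf
    obtain ⟨f', hf', hd⟩ := contDiff_succ_iff_hasFDerivAt.1 hf
    have hL : ContDiff ℝ n (ContinuousMap.pointwiseApply K E F) := ContinuousLinearMap.contDiff _
    exact contDiff_succ_iff_hasFDerivAt.2 ⟨fun u => ContinuousMap.pointwiseApply K E F
        ⟨fun t => f' (u t), hf'.continuous.comp u.continuous⟩,
      hL.comp (ih hf'),
      hasFDerivAt_postcomp hd hf'.continuous⟩

theorem contDiff_postcomp {K : Type*} {E F : Type u} [TopologicalSpace K] [CompactSpace K]
    [NormedAddCommGroup E] [NormedSpace ℝ E] [NormedAddCommGroup F] [NormedSpace ℝ F]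
    {f : E → F} (hf : ContDiff ℝ ∞ f) :
    ContDiff ℝ ∞
      (fun u : C(K, E) => (⟨fun t => f (u t), hf.continuous.comp u.continuous⟩ : C(K, F))) :=
  contDiff_infty.2 fun n => contDiff_postcomp_nat n (contDiff_infty.1 hf n)

variable {E : Type u} [NormedAddCommGroup E] [NormedSpace ℝ E]

/-- The primitive vanishing at `0` of a continuous curve on `[-1, 1]`. -/
def intervalPrimitive (E : Type*) [NormedAddCommGroup E] [NormedSpace ℝ E] :
    C(Icc (-1 : ℝ) 1, E) →L[ℝ] C(Icc (-1 : ℝ) 1, E) :=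
  have hle : (-1 : ℝ) ≤ 1 := by norm_num
  have hc : ∀ u : C(Icc (-1 : ℝ) 1, E), Continuous (IccExtend hle u) := fun u =>
    u.continuous.Icc_extend'
  LinearMap.mkContinuous
    { toFun := fun u => ⟨fun t => ∫ s in (0 : ℝ)..t, IccExtend hle u s,
        (intervalIntegral.continuous_primitive (fun a b => (hc u).intervalIntegrable a b) 0).comp
          continuous_subtype_val⟩
      map_add' := fun u v => by
        ext t
        exact intervalIntegral.integral_add ((hc u).intervalIntegrable _ _)
          ((hc v).intervalIntegrable _ _)
      map_smul' := fun c u => by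
        ext t
        exact intervalIntegral.integral_smul c _ } 1
    (fun u => by
      rw [ContinuousMap.norm_le _ (by positivity)]
      intro t
      refine (intervalIntegral.norm_integral_le_of_norm_le_const (C := ‖u‖)
        (fun s _ => u.norm_coe_le_norm _)).trans ?_
      have : |(t : ℝ) - 0| ≤ 1 := by rw [sub_zero]; exact abs_le.2 t.2
      nlinarith [norm_nonneg u])

/-- The operator whose zeros are the solutions of `u' = τ f(u)`, `u 0 = x` on `[-1, 1]`. -/
def picardDefect {f : E → E} (hf : Continuous f)
    (z : (ℝ × E) × C(Icc (-1 : ℝ) 1, E)) : C(Icc (-1 : ℝ) 1, E) :=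
  z.2 - ContinuousLinearMap.const ℝ _ z.1.2 -
    z.1.1 • intervalPrimitive E ⟨fun t => f (z.2 t), hf.comp z.2.continuous⟩

theorem contDiff_picardDefect {f : E → E} (hf : ContDiff ℝ ∞ f) :
    ContDiff ℝ ∞ (picardDefect hf.continuous) := by
  have hN : ContDiff ℝ ∞ (fun z : (ℝ × E) × C(Icc (-1 : ℝ) 1, E) => (⟨fun t => f (z.2 t),
      hf.continuous.comp z.2.continuous⟩ : C(Icc (-1 : ℝ) 1, E))) :=
    (contDiff_postcomp (K := Icc (-1 : ℝ) 1) hf).comp contDiff_snd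
  have hJ : ContDiff ℝ ∞ (intervalPrimitive E) := ContinuousLinearMap.contDiff _
  have hc : ContDiff ℝ ∞ (ContinuousLinearMap.const ℝ (Icc (-1 : ℝ) 1) : E →L[ℝ] _) :=
    ContinuousLinearMap.contDiff _
  exact (contDiff_snd.sub (hc.comp (contDiff_snd.comp contDiff_fst))).sub
    ((contDiff_fst.comp contDiff_fst).smul (hJ.comp hN))

/-- At τ = 0 the factor τ kills the dependence of the integral term on the curve, so the partial
derivative in the curve is the identity. -/
theorem hasFDerivAt_picardDefect {f : E → E} (hf : ContDiff ℝ ∞ f) (x₀ : E) :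
    ∃ L : (ℝ × E) →L[ℝ] C(Icc (-1 : ℝ) 1, E),
      HasFDerivAt (picardDefect hf.continuous)
        (ContinuousLinearMap.snd ℝ (ℝ × E) C(Icc (-1 : ℝ) 1, E) +
          L.comp (ContinuousLinearMap.fst ℝ (ℝ × E) C(Icc (-1 : ℝ) 1, E)))
        ((0, x₀), ContinuousMap.const _ x₀) := by
  have hN : ContDiff ℝ ∞ (fun z : (ℝ × E) × C(Icc (-1 : ℝ) 1, E) => (⟨fun t => f (z.2 t),
      hf.continuous.comp z.2.continuous⟩ : C(Icc (-1 : ℝ) 1, E))) :=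
    (contDiff_postcomp (K := Icc (-1 : ℝ) 1) hf).comp contDiff_snd
  have hJ : ContDiff ℝ ∞ (intervalPrimitive E) := ContinuousLinearMap.contDiff _
  set a : (ℝ × E) × C(Icc (-1 : ℝ) 1, E) := ((0, x₀), ContinuousMap.const _ x₀) with ha
  have hG := ((hJ.comp hN).differentiable (by simp) a).hasFDerivAt
  have h1 : HasFDerivAt (fun z : (ℝ × E) × C(Icc (-1 : ℝ) 1, E) => z.1.1)
    ((ContinuousLinearMap.fst ℝ ℝ E).comp (ContinuousLinearMap.fst ℝ (ℝ × E) _)) a :=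
    hasFDerivAt_fst.comp a hasFDerivAt_fst
  have h2 : HasFDerivAt (fun z : (ℝ × E) × C(Icc (-1 : ℝ) 1, E) =>
      z.2 - ContinuousLinearMap.const ℝ _ z.1.2)
    (ContinuousLinearMap.snd ℝ (ℝ × E) C(Icc (-1 : ℝ) 1, E) -
      (ContinuousLinearMap.const ℝ (Icc (-1 : ℝ) 1)).comp ((ContinuousLinearMap.snd ℝ ℝ E).comp
        (ContinuousLinearMap.fst ℝ (ℝ × E) C(Icc (-1 : ℝ) 1, E)))) a :=
    hasFDerivAt_snd.sub ((ContinuousLinearMap.hasFDerivAt _).comp a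
      (hasFDerivAt_snd.comp a hasFDerivAt_fst))
  refine ⟨-(ContinuousLinearMap.const ℝ (Icc (-1 : ℝ) 1)).comp (ContinuousLinearMap.snd ℝ ℝ E) -
    (ContinuousLinearMap.fst ℝ ℝ E).smulRight (intervalPrimitive E ⟨fun t => f (a.2 t),
      hf.continuous.comp a.2.continuous⟩), ?_⟩
  refine (h2.sub (h1.smul hG)).congr_fderiv ?_
  ext z t <;> simp [ha, sub_eq_add_neg]

theorem picardDefect_eq_zero_iff {f : E → E} (hf : Continuous f) {τ : ℝ} {x : E}
    {u : C(Icc (-1 : ℝ) 1, E)} :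
    picardDefect hf ((τ, x), u) = 0 ↔ ∀ t : Icc (-1 : ℝ) 1,
      u t = x + τ • ∫ s in (0 : ℝ)..t, f (IccExtend (by norm_num : (-1 : ℝ) ≤ 1) u s) := by
  rw [ContinuousMap.ext_iff]
  refine forall_congr' fun t => ?_
  change u t - x - τ • (∫ s in (0 : ℝ)..t, f (IccExtend (by norm_num : (-1 : ℝ) ≤ 1) u s)) = 0 ↔ _
  rw [sub_sub, sub_eq_zero]

theorem mul_mem_Icc_neg_one_one {r t : ℝ} (hr : r ∈ Icc (-1 : ℝ) 1) (ht : t ∈ Icc (-1 : ℝ) 1) :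
    r * t ∈ Icc (-1 : ℝ) 1 := by
  have h := mul_le_mul (abs_le.2 hr) (abs_le.2 ht) (abs_nonneg t) zero_le_one
  rw [← abs_mul, one_mul] at h
  exact abs_le.1 h

/-- The reparametrization `t ↦ u (r t)` of a curve on `[-1, 1]`. -/
def rescaleCurve (u : C(Icc (-1 : ℝ) 1, E)) (r : Icc (-1 : ℝ) 1) : C(Icc (-1 : ℝ) 1, E) :=
  ⟨fun t => u ⟨r * t, mul_mem_Icc_neg_one_one r.2 t.2⟩, by fun_prop⟩

/-- Substituting s ↦ rs in the integral turns a solution for τ into one for τr. With uniqueness,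
this relates the solutions at different values of τ. -/
theorem picardDefect_rescale {f : E → E} (hf : Continuous f) {τ : ℝ} {x : E}
    {u : C(Icc (-1 : ℝ) 1, E)} (hu : picardDefect hf ((τ, x), u) = 0) (r : Icc (-1 : ℝ) 1) :
    picardDefect hf ((τ * r, x), rescaleCurve u r) = 0 := by
  rw [picardDefect_eq_zero_iff] at hu ⊢
  intro t
  change u ⟨r * t, mul_mem_Icc_neg_one_one r.2 t.2⟩ = _
  rw [hu, mul_smul]
  congr 2
  have h0 := intervalIntegral.smul_integral_comp_mul_left (a := 0) (b := (t : ℝ))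
    (fun s => f (IccExtend (by norm_num : (-1 : ℝ) ≤ 1) u s)) r
  rw [mul_zero] at h0
  rw [← h0]
  congr 1
  refine intervalIntegral.integral_congr fun s hs => ?_
  have hs' : s ∈ Icc (-1 : ℝ) 1 :=
    uIcc_subset_Icc (by norm_num) t.2 hs
  simp only [IccExtend_of_mem _ _ hs', IccExtend_of_mem _ _ (mul_mem_Icc_neg_one_one r.2 hs')]
  rfl

/-- The map (y, u) ↦ (y, defect) has an invertible shear as derivative at the constant curve, so its
local inverse yields a solution u_{τ,x} depending smoothly on (τ, x). The flow is φ(τ, x) =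
u_{τ,x}(1). -/
theorem exists_contDiffOn_localFlow [CompleteSpace E] {f : E → E} (hf : ContDiff ℝ ∞ f) (x₀ : E) :
    ∃ δ > 0, ∃ φ : ℝ × E → E, ContDiffOn ℝ ∞ φ (ball (0, x₀) δ) ∧
      ∀ z ∈ ball ((0 : ℝ), x₀) δ, φ (0, z.2) = z.2 ∧
        HasDerivAt (fun t => φ (t, z.2)) (f (φ z)) z.1 := by
  have hle : (-1 : ℝ) ≤ 1 := by norm_num
  obtain ⟨L, hL⟩ := hasFDerivAt_picardDefect hf x₀
  set a : (ℝ × E) × C(Icc (-1 : ℝ) 1, E) := ((0, x₀), ContinuousMap.const _ x₀) with ha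
  let F : (ℝ × E) × C(Icc (-1 : ℝ) 1, E) → (ℝ × E) × C(Icc (-1 : ℝ) 1, E) :=
    fun z => (z.1, picardDefect hf.continuous z)
  have hFc : ContDiff ℝ ∞ F := contDiff_fst.prodMk (contDiff_picardDefect hf)
  let e : ((ℝ × E) × C(Icc (-1 : ℝ) 1, E)) ≃L[ℝ] ((ℝ × E) × C(Icc (-1 : ℝ) 1, E)) :=
    ContinuousLinearEquiv.skewProd (ContinuousLinearEquiv.refl ℝ _)
      (ContinuousLinearEquiv.refl ℝ _) L
  have hFd : HasFDerivAt F (e : _ →L[ℝ] _) a := by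
    refine (hasFDerivAt_fst.prodMk hL).congr_fderiv ?_
    ext z <;> rfl
  have hFa : F a = ((0, x₀), 0) := by
    refine Prod.ext rfl ?_
    change picardDefect hf.continuous ((0, x₀), _) = 0
    rw [picardDefect_eq_zero_iff]
    intro t
    simp
  let P := hFc.contDiffAt.toOpenPartialHomeomorph F hFd (by simp)
  have haP : a ∈ P.source := hFc.contDiffAt.mem_toOpenPartialHomeomorph_source hFd (by simp)
  -- Invertibility of the derivative is an open condition. It makes the local inverse smooth at all
  -- nearby points, not only at the image of `a`.
  have hinv : ∀ᶠ z in 𝓝 a, fderiv ℝ F z ∈ range (ContinuousLinearEquiv.toContinuousLinearMap :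
      (((ℝ × E) × C(Icc (-1 : ℝ) 1, E)) ≃L[ℝ] ((ℝ × E) × C(Icc (-1 : ℝ) 1, E))) → _) := by
    have hcont : ContinuousAt (fderiv ℝ F) a := (hFc.continuous_fderiv (by simp)).continuousAt
    refine hcont.eventually ?_
    rw [hFd.fderiv]
    exact e.nhds
  obtain ⟨ε, hε, hεs⟩ := Metric.eventually_nhds_iff_ball.1
    (hinv.and (P.open_source.mem_nhds haP))
  have hFaP : ((0, x₀), 0) ∈ P.target := by
    rw [← hFa]; exact P.map_source haP
  have hPa : P.symm ((0, x₀), 0) = a := by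
    rw [← hFa]; exact P.left_inv haP
  have hev : ∀ᶠ y in 𝓝 ((0 : ℝ), x₀), (y, (0 : C(Icc (-1 : ℝ) 1, E))) ∈ P.target ∧
      P.symm (y, 0) ∈ ball a ε := by
    have hc : ContinuousAt (fun y : ℝ × E => (y, (0 : C(Icc (-1 : ℝ) 1, E)))) (0, x₀) := by
      fun_prop
    have hs : ∀ᶠ y in 𝓝 (((0 : ℝ), x₀), (0 : C(Icc (-1 : ℝ) 1, E))), P.symm y ∈ ball a ε := by
      refine (P.continuousAt_symm hFaP).eventually ?_
      rw [hPa]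
      exact ball_mem_nhds _ hε
    exact (hc.eventually (P.open_target.mem_nhds hFaP)).and (hc.eventually hs)
  obtain ⟨δ, hδ, hδs⟩ := Metric.eventually_nhds_iff_ball.1 hev
  let u : ℝ × E → C(Icc (-1 : ℝ) 1, E) := fun y => (P.symm (y, 0)).2
  have hu : ∀ y ∈ ball ((0 : ℝ), x₀) δ, P.symm (y, 0) = (y, u y) ∧
      picardDefect hf.continuous (y, u y) = 0 ∧ u y ∈ ball (ContinuousMap.const _ x₀) ε := by
    intro y hy
    have h1 : F (P.symm (y, 0)) = (y, 0) := P.right_inv (hδs y hy).1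
    have h2 : P.symm (y, 0) = (y, u y) := Prod.ext (show (F (P.symm (y, 0))).1 = y by rw [h1]) rfl
    have h3 := (hδs y hy).2
    rw [h2] at h1
    rw [ha, ← ball_prod_same] at h3
    exact ⟨h2, congrArg Prod.snd h1, h3.2⟩
  have huniq : ∀ y ∈ ball ((0 : ℝ), x₀) δ, y ∈ ball ((0 : ℝ), x₀) ε → ∀ w : C(Icc (-1 : ℝ) 1, E),
      w ∈ ball (ContinuousMap.const _ x₀) ε → picardDefect hf.continuous (y, w) = 0 → u y = w := by
    intro y hy hyε w hw h0
    have hmem : (y, w) ∈ ball a ε := by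
      rw [ha, ← ball_prod_same]; exact ⟨hyε, hw⟩
    have h1 : P.symm (y, 0) = (y, w) := by
      have : F (y, w) = (y, 0) := Prod.ext rfl h0
      rw [← this]
      exact P.left_inv (hεs _ hmem).2
    exact congrArg Prod.snd h1
  have hyε : ∀ y ∈ ball ((0 : ℝ), x₀) δ, y ∈ ball ((0 : ℝ), x₀) ε := by
    intro y hy
    have h3 := (hδs y hy).2
    rw [(hu y hy).1, ha, ← ball_prod_same] at h3
    exact h3.1
  have one_mem : (1 : ℝ) ∈ Icc (-1 : ℝ) 1 := by norm_num
  have hresc : ∀ τ x, (τ, x) ∈ ball ((0 : ℝ), x₀) δ → ∀ r : Icc (-1 : ℝ) 1,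
      u (τ * r, x) = rescaleCurve (u (τ, x)) r := by
    intro τ x hy r
    have hy' : (τ * r, x) ∈ ball ((0 : ℝ), x₀) δ := by
      rw [← ball_prod_same] at hy ⊢
      refine ⟨?_, hy.2⟩
      have h1 := hy.1
      rw [mem_ball_zero_iff, Real.norm_eq_abs] at h1 ⊢
      rw [abs_mul]
      nlinarith [abs_le.2 r.2, abs_nonneg τ, abs_nonneg (r : ℝ)]
    refine huniq _ hy' (hyε _ hy') _ ?_ (picardDefect_rescale _ (hu _ hy).2.1 r)
    have h2 := (hu _ hy).2.2
    rw [mem_ball, ContinuousMap.dist_lt_iff hε] at h2 ⊢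
    intro t
    exact h2 _
  refine ⟨δ, hδ, fun y => u y ⟨1, one_mem⟩, ?_, ?_⟩
  · intro y hy
    obtain ⟨e', he'⟩ := (hεs _ (hδs y hy).2).1
    have h1 : ContDiffAt ℝ ∞ P.symm (y, 0) := by
      refine P.contDiffAt_symm (f₀' := e') (hδs y hy).1 ?_ hFc.contDiffAt
      rw [he']
      exact (hFc.differentiable (by simp) _).hasFDerivAt
    have h2 : ContDiffAt ℝ ∞ (fun y : ℝ × E => P.symm (y, (0 : C(Icc (-1 : ℝ) 1, E)))) y :=
      h1.comp y (contDiff_id.prodMk contDiff_const).contDiffAt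
    have h3 : ContDiff ℝ ∞ (ContinuousMap.evalCLM ℝ (⟨1, one_mem⟩ : Icc (-1 : ℝ) 1) :
      C(Icc (-1 : ℝ) 1, E) →L[ℝ] E) := ContinuousLinearMap.contDiff _
    exact (h3.contDiffAt.comp y (contDiff_snd.contDiffAt.comp y h2)).contDiffWithinAt
  · rintro ⟨τ, x⟩ hy
    have hyx := hy
    rw [← ball_prod_same] at hyx
    have h0 : (0, x) ∈ ball ((0 : ℝ), x₀) δ := by
      rw [← ball_prod_same]; exact ⟨mem_ball_self hδ, hyx.2⟩
    constructor
    · have := (picardDefect_eq_zero_iff hf.continuous).1 (hu _ h0).2.1 ⟨1, one_mem⟩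
      simpa using this
    · have hτ : |τ| < δ := by simpa using hyx.1
      -- With |τ| < σ < δ, the single curve u_{σ,x} describes all times near τ through φ(t, x) =
      -- u_{σ,x}(t/σ). The fundamental theorem of calculus then gives the time derivative.
      obtain ⟨σ, hσ1, hσ2⟩ := exists_between hτ
      have hσ0 : 0 < σ := (abs_nonneg τ).trans_lt hσ1
      have hσm : (σ, x) ∈ ball ((0 : ℝ), x₀) δ := by
        rw [← ball_prod_same]
        exact ⟨by rw [mem_ball_zero_iff, Real.norm_eq_abs, abs_of_pos hσ0]; exact hσ2, hyx.2⟩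
      have key : ∀ t, |t| < σ → u (t, x) ⟨1, one_mem⟩ = IccExtend hle (u (σ, x)) (t / σ) ∧
          u (t, x) ⟨1, one_mem⟩ =
            x + σ • ∫ s in (0 : ℝ)..(t / σ), f (IccExtend hle (u (σ, x)) s) := by
        intro t ht
        have hr : t / σ ∈ Icc (-1 : ℝ) 1 := by
          rw [mem_Icc, ← abs_le, abs_div, abs_of_pos hσ0, div_le_one hσ0]
          exact ht.le
        have h1 := hresc σ x hσm ⟨t / σ, hr⟩
        rw [mul_div_cancel₀ _ hσ0.ne'] at h1
        have h2 : u (t, x) ⟨1, one_mem⟩ = u (σ, x) ⟨t / σ, hr⟩ := by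
          rw [h1]
          change u (σ, x) _ = _
          congr 2
          exact mul_one _
        refine ⟨by rw [h2, IccExtend_of_mem _ _ hr], ?_⟩
        rw [h2]
        exact (picardDefect_eq_zero_iff hf.continuous).1 (hu _ hσm).2.1 ⟨t / σ, hr⟩
      have hcF : Continuous fun s => f (IccExtend hle (u (σ, x)) s) :=
        hf.continuous.comp (u (σ, x)).continuous.Icc_extend'
      have hd := (hcF.integral_hasStrictDerivAt 0 (τ / σ)).hasDerivAt
      have hd2 := ((hd.scomp τ ((hasDerivAt_id τ).div_const σ)).const_smul σ).const_add x
      rw [smul_smul, mul_one_div_cancel hσ0.ne', one_smul, ← (key τ hσ1).1] at hd2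
      refine hd2.congr_of_eventuallyEq ?_
      filter_upwards [(continuous_abs.tendsto τ).eventually (gt_mem_nhds hσ1)] with t ht
      exact (key t ht).2

end LocalFlow

/-! ### Vector fields in charts and local flows on a manifold -/

section ChartExpressions

open Metric Filter Topology

variable {m : ℕ} {M : Type*} [TopologicalSpace M] [ChartedSpace (EucSp m) M]
  [IsManifold (𝓡 m) ∞ M]

/-- The expression of a vector field in the preferred chart at `q`. -/
def VecField.chartRep (X : VecField m M) (q : M) : EucSp m → EucSp m :=
  fun y => mfderiv (𝓡 m) 𝓘(ℝ, EucSp m) (extChartAt (𝓡 m) q) ((extChartAt (𝓡 m) q).symm y)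
    (X ((extChartAt (𝓡 m) q).symm y))

theorem contDiffOn_chartRep {X : VecField m M} (hX : IsSmoothVecField X) (q : M) :
    ContDiffOn ℝ ∞ (X.chartRep q) (extChartAt (𝓡 m) q).target := by
  have h1 := ((trivializationAt (EucSp m) (TangentSpace (𝓡 m)) q).contMDiffOn_section_baseSet_iff
    (IB := 𝓡 m) (n := ∞) (s := X)).1 hX.contMDiffOn
  rw [TangentBundle.trivializationAt_baseSet] at h1
  have h2 := h1.comp (contMDiffOn_extChartAt_symm (I := 𝓡 m) (n := ∞) q) (fun y hy => by
    have := (extChartAt (𝓡 m) q).map_target hy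
    rwa [extChartAt_source] at this)
  rw [contMDiffOn_iff_contDiffOn] at h2
  refine h2.congr fun y hy => ?_
  have hy' := (extChartAt (𝓡 m) q).map_target hy
  rw [extChartAt_source] at hy'
  rw [VecField.chartRep, ← TangentBundle.continuousLinearMapAt_trivializationAt hy']
  exact Bundle.Trivialization.continuousLinearMapAt_apply_of_mem _ _ hy' _

theorem mfderiv_extChartAt_symm_comp (q : M) {y : EucSp m}
    (hy : y ∈ (extChartAt (𝓡 m) q).target) (v : TangentSpace (𝓡 m) ((extChartAt (𝓡 m) q).symm y)) :
    mfderiv 𝓘(ℝ, EucSp m) (𝓡 m) (extChartAt (𝓡 m) q).symm y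
      (mfderiv (𝓡 m) 𝓘(ℝ, EucSp m) (extChartAt (𝓡 m) q) ((extChartAt (𝓡 m) q).symm y) v) = v := by
  have h := mfderivWithin_extChartAt_symm_comp_mfderiv_extChartAt (I := 𝓡 m) hy
  rw [ModelWithCorners.range_eq_univ, mfderivWithin_univ] at h
  exact congrArg (fun L => L v) h

theorem mdifferentiableAt_extChartAt_symm' (q : M) {y : EucSp m}
    (hy : y ∈ (extChartAt (𝓡 m) q).target) :
    MDifferentiableAt 𝓘(ℝ, EucSp m) (𝓡 m) (extChartAt (𝓡 m) q).symm y := by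
  have h := mdifferentiableWithinAt_extChartAt_symm (I := 𝓡 m) hy
  rwa [ModelWithCorners.range_eq_univ, mdifferentiableWithinAt_univ] at h

/-- A smooth map on a neighbourhood can be replaced by a global one. -/
theorem exists_contDiff_eqOn_ball {s : Set (EucSp m)} {g : EucSp m → EucSp m}
    (hg : ContDiffOn ℝ ∞ g s) (hs : IsOpen s) {y₀ : EucSp m} (hy : y₀ ∈ s) :
    ∃ f : EucSp m → EucSp m, ContDiff ℝ ∞ f ∧ ∃ r > 0, ball y₀ r ⊆ s ∧ EqOn f g (ball y₀ r) := by
  obtain ⟨R, hR, hRs⟩ := Metric.isOpen_iff.1 hs y₀ hy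
  -- The bump is 1 on the ball of radius R/4 and vanishes beyond R/2, strictly inside the ball of
  -- radius R where `g` is smooth.
  let b : ContDiffBump y₀ := ⟨R / 4, R / 2, by linarith, by linarith⟩
  refine ⟨fun y => b y • g y, ?_, R / 4, by linarith,
    (ball_subset_ball (by linarith)).trans hRs, fun y hy => ?_⟩
  · rw [contDiff_iff_contDiffAt]
    intro y
    by_cases hyR : y ∈ ball y₀ R
    · exact b.contDiffAt.smul (hg.contDiffAt (hs.mem_nhds (hRs hyR)))
    · have hev : (fun y => b y • g y) =ᶠ[𝓝 y] fun _ => 0 := by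
        have hy2 : y ∈ (closedBall y₀ (R / 2))ᶜ := fun h =>
          hyR (closedBall_subset_ball (by linarith) h)
        filter_upwards [isClosed_closedBall.isOpen_compl.mem_nhds hy2] with z hz
        have : b z = 0 := b.zero_of_le_dist (by
          rw [mem_compl_iff, mem_closedBall, not_le] at hz
          exact hz.le)
        rw [this, zero_smul]
      exact contDiffAt_const.congr_of_eventuallyEq hev
  · have : b y = 1 := b.one_of_mem_closedBall (ball_subset_closedBall hy)
    simp only [this, one_smul]

/-- Local flow of a smooth vector field on a manifold, depending smoothly on time and space. -/
theorem exists_contMDiffOn_localFlow {X : VecField m M} (hX : IsSmoothVecField X) (q : M) :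
    ∃ ε > 0, ∃ U : Set M, IsOpen U ∧ q ∈ U ∧ ∃ ψ : ℝ × M → M,
      ContMDiffOn (𝓘(ℝ, ℝ).prod (𝓡 m)) (𝓡 m) ∞ ψ (Ioo (-ε) ε ×ˢ U) ∧
      ∀ p ∈ U, ψ (0, p) = p ∧
        IsMIntegralCurveOn (I := 𝓡 m) (fun t => ψ (t, p)) X (Ioo (-ε) ε) := by
  set c := extChartAt (𝓡 m) q with hc
  obtain ⟨f, hf, r, hr, hrs, hfr⟩ := exists_contDiff_eqOn_ball (contDiffOn_chartRep hX q)
    (isOpen_extChartAt_target q) (mem_extChartAt_target q)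
  obtain ⟨δ, hδ, φ, hφ, hφd⟩ := exists_contDiffOn_localFlow hf (c q)
  have h0 : ((0 : ℝ), c q) ∈ ball ((0 : ℝ), c q) δ := mem_ball_self hδ
  have hφ0 : ContinuousAt φ (0, c q) :=
    (hφ.contDiffAt (isOpen_ball.mem_nhds h0)).continuousAt
  -- The coordinate flow must stay where `f` agrees with the chart expression of `X`.
  have hev : ∀ᶠ z in 𝓝 ((0 : ℝ), c q), z ∈ ball ((0 : ℝ), c q) δ ∧ φ z ∈ ball (c q) r := by
    refine Eventually.and (isOpen_ball.mem_nhds h0) (hφ0.eventually ?_)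
    rw [(hφd _ h0).1]
    exact ball_mem_nhds _ hr
  obtain ⟨ε, hε, hεs⟩ := Metric.eventually_nhds_iff_ball.1 hev
  let U : Set M := c.source ∩ c ⁻¹' ball (c q) ε
  have hUo : IsOpen U := (continuousOn_extChartAt q).isOpen_inter_preimage
    (isOpen_extChartAt_source q) isOpen_ball
  have hmem : ∀ t ∈ Ioo (-ε) ε, ∀ p ∈ U, (t, c p) ∈ ball ((0 : ℝ), c q) ε := by
    intro t ht p hp
    rw [← ball_prod_same]
    refine ⟨?_, hp.2⟩
    rw [mem_ball_zero_iff, Real.norm_eq_abs, abs_lt]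
    exact ht
  refine ⟨ε, hε, U, hUo, ⟨mem_extChartAt_source q, mem_ball_self hε⟩,
    fun z => c.symm (φ (z.1, c z.2)), ?_, fun p hp => ⟨?_, ?_⟩⟩
  · have h1 : ContMDiffOn (𝓘(ℝ, ℝ).prod (𝓡 m)) 𝓘(ℝ, ℝ × EucSp m) ∞
        (fun z : ℝ × M => (z.1, c z.2)) (Ioo (-ε) ε ×ˢ U) := by
      refine contMDiffOn_fst.prodMk_space ?_
      refine (contMDiffOn_extChartAt (I := 𝓡 m) (n := ∞) (x := q)).comp contMDiffOn_snd ?_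
      intro z hz
      have := hz.2.1
      rwa [hc, extChartAt_source] at this
    have h2 : ContMDiffOn (𝓘(ℝ, ℝ).prod (𝓡 m)) 𝓘(ℝ, EucSp m) ∞
        (fun z : ℝ × M => φ (z.1, c z.2)) (Ioo (-ε) ε ×ˢ U) :=
      (contMDiffOn_iff_contDiffOn.2 hφ).comp h1 fun z hz => (hεs _ (hmem _ hz.1 _ hz.2)).1
    exact (contMDiffOn_extChartAt_symm (I := 𝓡 m) (n := ∞) q).comp h2 fun z hz =>
      hrs (hεs _ (hmem _ hz.1 _ hz.2)).2
  · have := hφd _ (hεs _ (hmem 0 ⟨by linarith, hε⟩ p hp)).1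
    change c.symm (φ (0, c p)) = p
    rw [this.1]
    exact c.left_inv hp.1
  · intro t ht
    obtain ⟨hb, hb2⟩ := hεs _ (hmem t ht p hp)
    have hd := (hφd _ hb).2
    have h1 : HasMFDerivAt 𝓘(ℝ, ℝ) 𝓘(ℝ, EucSp m) (fun t => φ (t, c p)) t
      ((1 : ℝ →L[ℝ] ℝ).smulRight (f (φ (t, c p)))) := hd.hasFDerivAt.hasMFDerivAt
    have h2 := (mdifferentiableAt_extChartAt_symm' q (hrs hb2)).hasMFDerivAt.comp t h1
    refine (h2.hasMFDerivWithinAt (s := Ioo (-ε) ε)).congr_mfderiv ?_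
    refine ContinuousLinearMap.ext_ring ?_
    have h3 := mfderiv_extChartAt_symm_comp q (hrs hb2) (X (c.symm (φ (t, c p))))
    have h4 : mfderiv 𝓘(ℝ, EucSp m) (𝓡 m) c.symm (φ (t, c p)) (f (φ (t, c p))) =
        X (c.symm (φ (t, c p))) := by
      rw [hfr hb2]
      exact h3
    change mfderiv 𝓘(ℝ, EucSp m) (𝓡 m) c.symm (φ (t, c p)) ((1 : ℝ) • f (φ (t, c p))) =
      (1 : ℝ) • X (c.symm (φ (t, c p)))
    rw [one_smul, one_smul]
    exact h4

end ChartExpressions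

/-! ### The maximal flow of a smooth vector field -/

section MaximalFlow

open Metric Filter Topology

variable {m : ℕ} {M : Type*} [TopologicalSpace M] [ChartedSpace (EucSp m) M]

/-- The pairs `(s, p)` such that the integral curve of `X` through `p` exists up to time `s`. -/
def flowDomain (X : VecField m M) : Set (ℝ × M) :=
  {z | ∃ (γ : ℝ → M) (a b : ℝ), 0 ∈ Ioo a b ∧ z.1 ∈ Ioo a b ∧ γ 0 = z.2 ∧
    IsMIntegralCurveOn (I := 𝓡 m) γ X (Ioo a b)}

open Classical in
/-- The maximal flow of a vector field. -/
def maxFlow (X : VecField m M) (z : ℝ × M) : M :=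
  if h : z ∈ flowDomain X then h.choose z.1 else z.2

theorem ordConnected_flowDomain (X : VecField m M) (p : M) :
    {s : ℝ | (s, p) ∈ flowDomain X}.OrdConnected := by
  have key : ∀ s, (s, p) ∈ flowDomain X → uIcc 0 s ⊆ {s : ℝ | (s, p) ∈ flowDomain X} := by
    rintro s ⟨γ, a, b, h0, hs, h⟩ t ht
    exact ⟨γ, a, b, h0, ordConnected_Ioo.uIcc_subset h0 hs ht, h⟩
  refine ordConnected_of_uIcc_subset_left (x := 0) fun s hs => key s hs

variable [IsManifold (𝓡 m) ∞ M] [T2Space M] {X : VecField m M}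

/-- Integral curves on a Hausdorff manifold are unique, so the chosen curve agrees with any other on
the common interval. -/
theorem maxFlow_eq (hX : IsSmoothVecField X) {γ : ℝ → M} {a b s : ℝ} {p : M}
    (h0 : 0 ∈ Ioo a b) (hs : s ∈ Ioo a b) (hγ0 : γ 0 = p)
    (hγ : IsMIntegralCurveOn (I := 𝓡 m) γ X (Ioo a b)) :
    (s, p) ∈ flowDomain X ∧ maxFlow X (s, p) = γ s := by
  have h : (s, p) ∈ flowDomain X := ⟨γ, a, b, h0, hs, hγ0, hγ⟩
  refine ⟨h, ?_⟩
  rw [maxFlow, dif_pos h]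
  obtain ⟨a', b', h0', hs', hγ0', hγ'⟩ := h.choose_spec
  refine isMIntegralCurveOn_Ioo_eqOn_of_contMDiff_boundaryless (I := 𝓡 m)
    (a := max a' a) (b := min b' b) (t₀ := 0)
    ⟨max_lt h0'.1 h0.1, lt_min h0'.2 h0.2⟩ (ContMDiff.of_le hX (by simp))
    (hγ'.mono (Ioo_subset_Ioo (le_max_left _ _) (min_le_left _ _)))
    (hγ.mono (Ioo_subset_Ioo (le_max_right _ _) (min_le_right _ _))) (hγ0'.trans hγ0.symm)
    ⟨max_lt hs'.1 hs.1, lt_min hs'.2 hs.2⟩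

theorem maxFlow_zero (hX : IsSmoothVecField X) (p : M) :
    (0, p) ∈ flowDomain X ∧ maxFlow X (0, p) = p := by
  obtain ⟨ε, hε, U, -, hp, ψ, -, hψ⟩ := exists_contMDiffOn_localFlow hX p
  obtain ⟨h0, hc⟩ := hψ p hp
  have h := maxFlow_eq hX (s := 0) ⟨by linarith, hε⟩ ⟨by linarith, hε⟩ h0 hc
  exact ⟨h.1, h.2.trans h0⟩

/-- The curve through `p` is glued at time `s` to the translated curve through its endpoint. -/
theorem maxFlow_add (hX : IsSmoothVecField X) {s t : ℝ} {p : M} (hs : (s, p) ∈ flowDomain X)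
    (ht : (t, maxFlow X (s, p)) ∈ flowDomain X) :
    (s + t, p) ∈ flowDomain X ∧ maxFlow X (s + t, p) = maxFlow X (t, maxFlow X (s, p)) := by
  obtain ⟨γ, a, b, h0, hsab, hγ0, hγ⟩ := hs
  have e1 := (maxFlow_eq hX h0 hsab hγ0 hγ).2
  obtain ⟨γ', a', b', h0', ht', hγ0', hγ'⟩ := ht
  have e2 := (maxFlow_eq hX h0' ht' hγ0' hγ').2
  simp only at hγ0' hγ0 ht' hsab e2 e1
  have hc := hγ'.comp_add (-s)
  have hset : {t | t + -s ∈ Ioo a' b'} = Ioo (a' + s) (b' + s) := by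
    ext x
    simp only [mem_ofPred_eq, mem_Ioo]
    constructor <;> rintro ⟨h1, h2⟩ <;> constructor <;> linarith
  rw [hset] at hc
  have hsc : s ∈ Ioo (a' + s) (b' + s) := ⟨by linarith [h0'.1], by linarith [h0'.2]⟩
  have hag : γ s = (γ' ∘ (· + -s)) s := by
    simp only [Function.comp_apply, add_neg_cancel]
    rw [hγ0', ← e1]
  have hp := isMIntegralCurveOn_piecewise (I := 𝓡 m) (ContMDiff.of_le hX (by simp)) hγ hc
    ⟨hsab, hsc⟩ hag
  have hq := eqOn_piecewise_of_isMIntegralCurveOn_Ioo (I := 𝓡 m) (ContMDiff.of_le hX (by simp)) hγ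
    hc ⟨hsab, hsc⟩ hag
  rw [Ioo_union_Ioo' (hsc.1.trans hsab.2) (hsab.1.trans hsc.2)] at hp
  have hst : s + t ∈ Ioo (a' + s) (b' + s) := ⟨by linarith [ht'.1], by linarith [ht'.2]⟩
  have h := maxFlow_eq hX (s := s + t) (p := p)
    ⟨(min_le_left _ _).trans_lt h0.1, h0.2.trans_le (le_max_left _ _)⟩
    ⟨(min_le_right _ _).trans_lt hst.1, hst.2.trans_le (le_max_right _ _)⟩
    (by rw [piecewise_eq_of_mem _ _ _ h0]; exact hγ0) hp
  refine ⟨h.1, h.2.trans ?_⟩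
  rw [hq hst, e2]
  simp

theorem maxFlow_neg (hX : IsSmoothVecField X) {s : ℝ} {p : M} (hs : (s, p) ∈ flowDomain X) :
    (-s, maxFlow X (s, p)) ∈ flowDomain X ∧ maxFlow X (-s, maxFlow X (s, p)) = p := by
  obtain ⟨γ, a, b, h0, hsab, hγ0, hγ⟩ := hs
  have e1 := (maxFlow_eq hX h0 hsab hγ0 hγ).2
  simp only at hγ0 hsab e1
  have hc := hγ.comp_add s
  have hset : {t | t + s ∈ Ioo a b} = Ioo (a - s) (b - s) := by
    ext x
    simp only [mem_ofPred_eq, mem_Ioo]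
    constructor <;> rintro ⟨h1, h2⟩ <;> constructor <;> linarith
  rw [hset] at hc
  have h := maxFlow_eq hX (s := -s) (p := maxFlow X (s, p)) (γ := γ ∘ (· + s))
    ⟨by linarith [hsab.1], by linarith [hsab.2]⟩ ⟨by linarith [h0.1], by linarith [h0.2]⟩
    (by simp [e1]) hc
  refine ⟨h.1, h.2.trans ?_⟩
  simp [hγ0]

/-- Flow back by -s from the endpoint, then forward by s + t. -/
theorem maxFlow_add' (hX : IsSmoothVecField X) {s t : ℝ} {p : M} (hs : (s, p) ∈ flowDomain X)
    (ht : (s + t, p) ∈ flowDomain X) :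
    (t, maxFlow X (s, p)) ∈ flowDomain X ∧
      maxFlow X (t, maxFlow X (s, p)) = maxFlow X (s + t, p) := by
  obtain ⟨h1, h2⟩ := maxFlow_neg hX hs
  have h := maxFlow_add hX h1 (t := s + t) (by rwa [h2])
  rwa [h2, neg_add_cancel_left] at h

theorem exists_contMDiffOn_maxFlow (hX : IsSmoothVecField X) (q : M) :
    ∃ ε > 0, ∃ U : Set M, IsOpen U ∧ q ∈ U ∧ Ioo (-ε) ε ×ˢ U ⊆ flowDomain X ∧
      ContMDiffOn (𝓘(ℝ, ℝ).prod (𝓡 m)) (𝓡 m) ∞ (maxFlow X) (Ioo (-ε) ε ×ˢ U) := by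
  obtain ⟨ε, hε, U, hU, hq, ψ, hψc, hψ⟩ := exists_contMDiffOn_localFlow hX q
  have key : ∀ z ∈ Ioo (-ε) ε ×ˢ U, z ∈ flowDomain X ∧ maxFlow X z = ψ z := fun z hz =>
    maxFlow_eq hX ⟨by linarith, hε⟩ hz.1 (hψ _ hz.2).1 (hψ _ hz.2).2
  exact ⟨ε, hε, U, hU, hq, fun z hz => (key z hz).1, hψc.congr fun z hz => (key z hz).2⟩

/-- Let W be the largest open part of the domain on which the flow is smooth. Along an integral
curve, the times t with (t, p) in W form a nonempty, open and relatively closed set, hence the whole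
interval. -/
theorem isOpen_flowDomain_and_contMDiffOn (hX : IsSmoothVecField X) :
    IsOpen (flowDomain X) ∧
      ContMDiffOn (𝓘(ℝ, ℝ).prod (𝓡 m)) (𝓡 m) ∞ (maxFlow X) (flowDomain X) := by
  set W : Set (ℝ × M) := ⋃₀ {V | IsOpen V ∧ V ⊆ flowDomain X ∧
    ContMDiffOn (𝓘(ℝ, ℝ).prod (𝓡 m)) (𝓡 m) ∞ (maxFlow X) V} with hW
  have hWo : IsOpen W := isOpen_sUnion fun V hV => hV.1
  have hWD : W ⊆ flowDomain X := sUnion_subset fun V hV => hV.2.1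
  have hWc : ContMDiffOn (𝓘(ℝ, ℝ).prod (𝓡 m)) (𝓡 m) ∞ (maxFlow X) W := by
    rintro z ⟨V, hV, hz⟩
    exact (hV.2.2.contMDiffAt (hV.1.mem_nhds hz)).contMDiffWithinAt
  suffices h : flowDomain X ⊆ W by
    rw [← hWD.antisymm h]
    exact ⟨hWo, hWc⟩
  rintro ⟨s, p⟩ ⟨γ, a, b, h0, hs, hγ0, hγ⟩
  simp only at hs hγ0
  have hsub : Ioo a b ⊆ {t | (t, p) ∈ W} := by
    refine isPreconnected_Ioo.subset_of_closure_inter_subset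
      (hWo.preimage (by fun_prop : Continuous fun t : ℝ => (t, p))) ⟨0, h0, ?_⟩ ?_
    · obtain ⟨ε, hε, U, hU, hq, hD, hc⟩ := exists_contMDiffOn_maxFlow hX p
      exact ⟨_, ⟨isOpen_Ioo.prod hU, hD, hc⟩, ⟨by linarith, hε⟩, hq⟩
    · rintro t₀ ⟨ht₀, htab⟩
      obtain ⟨ε, hε, U, hU, hq, hD, hc⟩ := exists_contMDiffOn_maxFlow hX (γ t₀)
      have hγc : ContinuousAt γ t₀ :=
        (hγ.continuousWithinAt htab).continuousAt (Ioo_mem_nhds htab.1 htab.2)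
      have hn : ∀ᶠ t in 𝓝 t₀, t ∈ Ioo a b ∧ γ t ∈ U ∧ t ∈ ball t₀ ε :=
        Eventually.and (Ioo_mem_nhds htab.1 htab.2)
          (Eventually.and (hγc.eventually (hU.mem_nhds hq)) (ball_mem_nhds _ hε))
      -- From a good time t₁ close to the limit time t₀, the flow near (t₀, p) is the smooth time-t₁
      -- flow followed by a short-time flow near γ t₀.
      obtain ⟨t₁, ⟨h1, h2, h3⟩, h4⟩ := mem_closure_iff_nhds.1 ht₀ _ hn
      have e1 := (maxFlow_eq hX h0 h1 hγ0 hγ).2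
      have hι : ContMDiff (𝓡 m) (𝓘(ℝ, ℝ).prod (𝓡 m)) ∞ (fun x : M => (t₁, x)) :=
        contMDiff_const.prodMk contMDiff_id
      set Y : Set M := {x | (t₁, x) ∈ W} with hY
      have hYo : IsOpen Y := hWo.preimage hι.continuous
      have hYc : ContMDiffOn (𝓡 m) (𝓡 m) ∞ (fun x => maxFlow X (t₁, x)) Y :=
        hWc.comp hι.contMDiffOn fun x hx => hx
      set Z : Set M := Y ∩ (fun x => maxFlow X (t₁, x)) ⁻¹' U with hZ
      have hZo : IsOpen Z := hYc.continuousOn.isOpen_inter_preimage hYo hU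
      have hmaps : ∀ z ∈ Ioo (t₁ - ε) (t₁ + ε) ×ˢ Z,
          (z.1 - t₁, maxFlow X (t₁, z.2)) ∈ Ioo (-ε) ε ×ˢ U := fun z hz =>
        ⟨⟨by linarith [hz.1.1], by linarith [hz.1.2]⟩, hz.2.2⟩
      have hadd : ∀ z ∈ Ioo (t₁ - ε) (t₁ + ε) ×ˢ Z, z ∈ flowDomain X ∧
          maxFlow X z = maxFlow X (z.1 - t₁, maxFlow X (t₁, z.2)) := by
        intro z hz
        have := maxFlow_add hX (hWD hz.2.1) (hD (hmaps z hz))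
        rwa [add_sub_cancel] at this
      refine ⟨Ioo (t₁ - ε) (t₁ + ε) ×ˢ Z, ⟨isOpen_Ioo.prod hZo, fun z hz => (hadd z hz).1, ?_⟩,
        ⟨?_, ?_⟩, h4, ?_⟩
      · refine ContMDiffOn.congr ?_ fun z hz => (hadd z hz).2
        refine hc.comp (ContMDiffOn.prodMk ?_ ?_) hmaps
        · have : ContDiff ℝ ∞ fun t : ℝ => t - t₁ := by fun_prop
          exact this.contMDiff.comp_contMDiffOn contMDiffOn_fst
        · exact hYc.comp contMDiffOn_snd fun z hz => hz.2.1
      · rw [mem_ball, Real.dist_eq, abs_lt] at h3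
        simp only
        linarith
      · rw [mem_ball, Real.dist_eq, abs_lt] at h3
        simp only
        linarith
      · change maxFlow X (t₁, p) ∈ U
        rwa [e1]
  exact hsub hs

/-- The maximal flow of a smooth vector field is a local one-parameter group. -/
theorem exists_localOneParamGroup (hX : IsSmoothVecField X) :
    ∃ Φ : LocalOneParamGroup m M, Φ.IsGeneratedBy X := by
  obtain ⟨hDo, hDc⟩ := isOpen_flowDomain_and_contMDiffOn hX
  have hι : ∀ s : ℝ, Continuous (fun x : M => (s, x)) := fun s => by fun_prop
  have hcont : ∀ s : ℝ, ContinuousOn (fun x => maxFlow X (s, x)) {x | (s, x) ∈ flowDomain X} :=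
    fun s => hDc.continuousOn.comp (hι s).continuousOn fun x hx => hx
  have hneg : ∀ (s : ℝ) (x : M), (-s, x) ∈ flowDomain X →
      (s, maxFlow X (-s, x)) ∈ flowDomain X ∧ maxFlow X (s, maxFlow X (-s, x)) = x := by
    intro s x hx
    have := maxFlow_neg hX hx
    rwa [neg_neg] at this
  let Φ : LocalOneParamGroup m M :=
    { toFun := fun s =>
        { toFun := fun x => maxFlow X (s, x)
          invFun := fun x => maxFlow X (-s, x)
          source := {x | (s, x) ∈ flowDomain X}
          target := {x | (-s, x) ∈ flowDomain X}
          map_source' := fun x hx => (maxFlow_neg hX hx).1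
          map_target' := fun x hx => (hneg s x hx).1
          left_inv' := fun x hx => (maxFlow_neg hX hx).2
          right_inv' := fun x hx => (hneg s x hx).2
          open_source := hDo.preimage (hι s)
          open_target := hDo.preimage (hι (-s))
          continuousOn_toFun := hcont s
          continuousOn_invFun := hcont (-s) }
      source_zero := eq_univ_of_forall fun x => (maxFlow_zero hX x).1
      map_zero := fun x => (maxFlow_zero hX x).2
      isOpen_domain := hDo
      smooth := hDc
      ordConnected := ordConnected_flowDomain X
      mem_source_iff := fun s t p hs => ⟨fun ht => (maxFlow_add hX hs ht).1,
        fun ht => (maxFlow_add' hX hs ht).1⟩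
      map_add := fun s t p hs ht => (maxFlow_add' hX hs ht).2 }
  refine ⟨Φ, fun p => ?_⟩
  obtain ⟨γ, a, b, h0, -, hγ0, hγ⟩ := (maxFlow_zero hX p).1
  have h1 := (hγ 0 h0).hasMFDerivAt (Ioo_mem_nhds h0.1 h0.2)
  have e0 : Φ.toFun 0 p = γ 0 := (maxFlow_zero hX p).2.trans hγ0.symm
  rw [e0]
  refine h1.congr_of_eventuallyEq ?_
  filter_upwards [Ioo_mem_nhds h0.1 h0.2] with t ht
  exact (maxFlow_eq hX h0 ht hγ0 hγ).2

end MaximalFlow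

/-! ### Time derivative of pullbacks and Cartan's formula on a normed space -/

section LieDerivativeCalculus

open Metric Filter Topology

variable {E : Type*} [NormedAddCommGroup E] [NormedSpace ℝ E]

/-- Interchange of the time and space derivatives of a flow at time `0`. -/
theorem hasDerivAt_fderiv_flow {ψ : ℝ × E → E} {Y : E → E} {y₀ : E}
    (hψ : ContDiffAt ℝ 2 ψ (0, y₀)) (hY : ∀ᶠ y in 𝓝 y₀, HasDerivAt (fun t => ψ (t, y)) (Y y) 0)
    (w : E) :
    HasDerivAt (fun t => fderiv ℝ (fun y => ψ (t, y)) y₀ w) (fderiv ℝ Y y₀ w) 0 := by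
  have hsymm : IsSymmSndFDerivAt ℝ ψ (0, y₀) := hψ.isSymmSndFDerivAt (by simp)
  have hD : DifferentiableAt ℝ (fderiv ℝ ψ) (0, y₀) :=
    (hψ.fderiv_right (m := 1) (by norm_num)).differentiableAt (by simp)
  have hd : ∀ᶠ z in 𝓝 ((0 : ℝ), y₀), DifferentiableAt ℝ ψ z := by
    filter_upwards [hψ.eventually (by simp)] with z hz
    exact hz.differentiableAt (by simp)
  have ht : Tendsto (fun t : ℝ => (t, y₀)) (𝓝 0) (𝓝 ((0 : ℝ), y₀)) :=
    (by fun_prop : Continuous fun t : ℝ => (t, y₀)).tendsto 0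
  have hs : Tendsto (fun y : E => ((0 : ℝ), y)) (𝓝 y₀) (𝓝 ((0 : ℝ), y₀)) :=
    (by fun_prop : Continuous fun y : E => ((0 : ℝ), y)).tendsto y₀
  have ins : ∀ (t : ℝ) (y : E), HasFDerivAt (fun y : E => (t, y)) (ContinuousLinearMap.inr ℝ ℝ E) y :=
    fun t y => (hasFDerivAt_const t y).prodMk (hasFDerivAt_id y)
  have int : ∀ (t : ℝ) (y : E), HasDerivAt (fun t : ℝ => (t, y)) ((1 : ℝ), (0 : E)) t :=
    fun t y => (hasDerivAt_id t).prodMk (hasDerivAt_const t y)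
  have hYeq : Y =ᶠ[𝓝 y₀] fun y => fderiv ℝ ψ (0, y) (1, 0) := by
    filter_upwards [hY, hs.eventually hd] with y h1 h2
    exact h1.unique (h2.hasFDerivAt.comp_hasDerivAt (0 : ℝ) (int 0 y))
  set D := fderiv ℝ (fderiv ℝ ψ) (0, y₀) with hDdef
  have hDa : ∀ a : ℝ × E, HasFDerivAt (fun z => fderiv ℝ ψ z a) (D.flip a) ((0 : ℝ), y₀) := by
    intro a
    refine (hD.hasFDerivAt.clm_apply (hasFDerivAt_const a _)).congr_fderiv ?_
    ext z <;> simp [hDdef]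
  have hYd : HasFDerivAt (fun y => fderiv ℝ ψ (0, y) (1, 0))
      ((D.flip (1, 0)).comp (ContinuousLinearMap.inr ℝ ℝ E)) y₀ :=
    HasFDerivAt.comp (g := fun z => fderiv ℝ ψ z (1, 0)) y₀ (hDa (1, 0)) (ins 0 y₀)
  -- Both derivatives are mixed second derivatives of ψ, equal by symmetry.
  have e1 : fderiv ℝ Y y₀ w = D (1, 0) (0, w) := by
    rw [hYeq.fderiv_eq, hYd.fderiv, hsymm.eq]
    rfl
  have h2 : HasDerivAt (fun t => fderiv ℝ ψ (t, y₀) (0, w)) (D.flip (0, w) (1, 0)) 0 :=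
    HasFDerivAt.comp_hasDerivAt (l := fun z => fderiv ℝ ψ z (0, w)) (0 : ℝ) (hDa (0, w)) (int 0 y₀)
  rw [e1]
  refine h2.congr_of_eventuallyEq ?_
  filter_upwards [ht.eventually hd] with t h
  have h3 : HasFDerivAt (fun y => ψ (t, y)) _ y₀ := h.hasFDerivAt.comp y₀ (ins t y₀)
  rw [h3.fderiv]
  rfl

/-- The derivative at time `0` of the pullback of a form by a flow. -/
theorem hasDerivAt_flow_pullback {ψ : ℝ × E → E} {Y : E → E} {y₀ : E} {k : ℕ}
    (hψ : ContDiffAt ℝ 2 ψ (0, y₀)) (hY : ∀ᶠ y in 𝓝 y₀, HasDerivAt (fun t => ψ (t, y)) (Y y) 0)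
    (hψ0 : ∀ᶠ y in 𝓝 y₀, ψ (0, y) = y) {α : E → E [⋀^Fin k]→L[ℝ] ℝ}
    (hα : DifferentiableAt ℝ α y₀) (v : Fin k → E) :
    HasDerivAt (fun t => α (ψ (t, y₀)) (fun i => fderiv ℝ (fun y => ψ (t, y)) y₀ (v i)))
      (fderiv ℝ α y₀ (Y y₀) v + ∑ i, α y₀ (Function.update v i (fderiv ℝ Y y₀ (v i)))) 0 := by
  have e0 : ψ (0, y₀) = y₀ := hψ0.self_of_nhds
  have eid : ∀ w, fderiv ℝ (fun y => ψ (0, y)) y₀ w = w := by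
    intro w
    have : (fun y => ψ (0, y)) =ᶠ[𝓝 y₀] id := hψ0
    rw [this.fderiv_eq, fderiv_id]
    rfl
  have h1 : HasFDerivAt (fun t => α (ψ (t, y₀))) _ (0 : ℝ) :=
    HasFDerivAt.comp (0 : ℝ) (by simp only [e0]; exact hα.hasFDerivAt)
      hY.self_of_nhds.hasFDerivAt
  have h2 := (h1.continuousAlternatingMap_apply
    (fun i => (hasDerivAt_fderiv_flow hψ hY (v i)).hasFDerivAt)).hasDerivAt
  refine h2.congr_deriv ?_
  simp [e0, eid]

/-- Cartan's formula for a form on a normed space. -/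
theorem extDeriv_curryLeft_add {k : ℕ} {α : E → E [⋀^Fin (k + 1)]→L[ℝ] ℝ} {Y : E → E} {y₀ : E}
    (hα : DifferentiableAt ℝ α y₀) (hY : DifferentiableAt ℝ Y y₀) (v : Fin (k + 1) → E) :
    extDeriv (fun y => (α y).curryLeft (Y y)) y₀ v + extDeriv α y₀ (Matrix.vecCons (Y y₀) v) =
      fderiv ℝ α y₀ (Y y₀) v + ∑ i, α y₀ (Function.update v i (fderiv ℝ Y y₀ (v i))) := by
  let L : (E [⋀^Fin (k + 1)]→L[ℝ] ℝ) →L[ℝ] (E →L[ℝ] E [⋀^Fin k]→L[ℝ] ℝ) :=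
    ContinuousAlternatingMap.curryLeftLI.toContinuousLinearMap
  have hL : HasFDerivAt L L (α y₀) := ContinuousLinearMap.hasFDerivAt
    (E := E [⋀^Fin (k + 1)]→L[ℝ] ℝ) (F := E →L[ℝ] E [⋀^Fin k]→L[ℝ] ℝ) L
  have hc := HasFDerivAt.comp (E := E) (F := E [⋀^Fin (k + 1)]→L[ℝ] ℝ)
    (G := E →L[ℝ] E [⋀^Fin k]→L[ℝ] ℝ) (g := L) (g' := L) y₀ hL hα.hasFDerivAt
  have hd := hc.clm_apply hY.hasFDerivAt
  have hι : ∀ h u, fderiv ℝ (fun y => (α y).curryLeft (Y y)) y₀ h u =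
      α y₀ (Matrix.vecCons (fderiv ℝ Y y₀ h) u) + fderiv ℝ α y₀ h (Matrix.vecCons (Y y₀) u) := by
    intro h u
    rw [show (fun y => (α y).curryLeft (Y y)) = fun y => (L ∘ α) y (Y y) from rfl, hd.fderiv]
    rfl
  simp only [extDeriv, ContinuousAlternatingMap.alternatizeUncurryFin_apply, hι]
  -- The index-0 term of dα is the derivative of α along Y. Its other terms cancel the part of d(Y ⌟
  -- α) in which α is differentiated, because inserting Y shifts the sign by one.
  rw [Fin.sum_univ_succ (n := k + 1)]
  have hrem : ∀ i : Fin (k + 1), Fin.removeNth i.succ (Matrix.vecCons (Y y₀) v) =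
      Matrix.vecCons (Y y₀) (i.removeNth v) := by
    intro i
    ext j
    refine Fin.cases ?_ (fun j => ?_) j <;> simp [Fin.removeNth_apply]
  have hup : ∀ i : Fin (k + 1), α y₀ (Function.update v i (fderiv ℝ Y y₀ (v i))) =
      (-1) ^ (i : ℕ) • α y₀ (Matrix.vecCons (fderiv ℝ Y y₀ (v i)) (i.removeNth v)) := by
    intro i
    rw [← Fin.insertNth_removeNth]
    exact (α y₀).toAlternatingMap.map_insertNth i _ _
  simp only [hrem, hup, Matrix.cons_val_succ, Fin.val_succ, pow_succ, smul_add,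
    Finset.sum_add_distrib]
  simp [Finset.sum_neg_distrib]
  ring

end LieDerivativeCalculus

/-! ### Local one-parameter groups: inverses, completeness, derivative of pullbacks at time 0 -/

section FlowProperties

open Metric Filter Topology

variable {m : ℕ} {M : Type*} [TopologicalSpace M] [ChartedSpace (EucSp m) M]
  {Φ : LocalOneParamGroup m M} {X : VecField m M}

/-- Typing the vectors in the model space lets the base point change without transport between
tangent spaces. -/
theorem DiffForm.apply_congr {k : ℕ} (α : DiffForm m M k) {x x' : M} {w w' : Fin k → EucSp m}
    (hx : x = x') (hw : w = w') : α x w = α x' w' := by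
  subst hx hw
  rfl

theorem LocalOneParamGroup.neg_mem_source (Φ : LocalOneParamGroup m M) {s : ℝ} {p : M}
    (hp : p ∈ (Φ.toFun s).source) :
    Φ.toFun s p ∈ (Φ.toFun (-s)).source ∧ Φ.toFun (-s) (Φ.toFun s p) = p := by
  have h0 : p ∈ (Φ.toFun (s + -s)).source := by
    rw [add_neg_cancel, Φ.source_zero]; trivial
  refine ⟨(Φ.mem_source_iff s (-s) p hp).2 h0, ?_⟩
  rw [Φ.map_add s (-s) p hp h0, add_neg_cancel, Φ.map_zero]

theorem LocalOneParamGroup.contMDiffOn (Φ : LocalOneParamGroup m M) (s : ℝ) :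
    ContMDiffOn (𝓡 m) (𝓡 m) ∞ (Φ.toFun s) (Φ.toFun s).source :=
  Φ.smooth.comp (t := {z : ℝ × M | z.2 ∈ (Φ.toFun z.1).source}) (f := fun x : M => (s, x))
    (contMDiff_const.prodMk contMDiff_id).contMDiffOn fun _ hx => hx

theorem LocalOneParamGroup.isTransformation (Φ : LocalOneParamGroup m M) (s : ℝ) :
    IsTransformation m (Φ.toFun s) := by
  refine ⟨Φ.contMDiffOn s, ?_⟩
  have key : ∀ x ∈ (Φ.toFun s).target, x ∈ (Φ.toFun (-s)).source ∧
      (Φ.toFun s).symm x = Φ.toFun (-s) x := by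
    intro x hx
    have h := Φ.neg_mem_source ((Φ.toFun s).map_target hx)
    rw [(Φ.toFun s).right_inv hx] at h
    exact ⟨h.1, h.2.symm⟩
  exact ((Φ.contMDiffOn (-s)).mono fun x hx => (key x hx).1).congr fun x hx => (key x hx).2

theorem LocalOneParamGroup.isOpen_times (Φ : LocalOneParamGroup m M) (p : M) :
    IsOpen {s : ℝ | p ∈ (Φ.toFun s).source} :=
  Φ.isOpen_domain.preimage (by fun_prop : Continuous fun s : ℝ => (s, p))

theorem LocalOneParamGroup.zero_mem (Φ : LocalOneParamGroup m M) (p : M) :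
    p ∈ (Φ.toFun 0).source := by
  rw [Φ.source_zero]; trivial

theorem LocalOneParamGroup.IsGeneratedBy.hasMFDerivAt_zero (hΦ : Φ.IsGeneratedBy X) (p : M) :
    HasMFDerivAt 𝓘(ℝ, ℝ) (𝓡 m) (fun s : ℝ => Φ.toFun s p) 0
      ((1 : ℝ →L[ℝ] ℝ).smulRight (X p : EucSp m)) := by
  have e : (X (Φ.toFun 0 p) : EucSp m) = X p :=
    congrArg (fun x => (X x : EucSp m)) (Φ.map_zero p)
  rw [← e]
  exact hΦ p

theorem LocalOneParamGroup.IsGeneratedBy.hasMFDerivAt (hΦ : Φ.IsGeneratedBy X) {s : ℝ} {p : M}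
    (hp : p ∈ (Φ.toFun s).source) :
    HasMFDerivAt 𝓘(ℝ, ℝ) (𝓡 m) (fun t : ℝ => Φ.toFun t p) s
      ((1 : ℝ →L[ℝ] ℝ).smulRight (X (Φ.toFun s p))) := by
  have h1 := hΦ.hasMFDerivAt_zero (Φ.toFun s p)
  have h2 : HasMFDerivAt 𝓘(ℝ, ℝ) 𝓘(ℝ, ℝ) (fun t : ℝ => t - s) s (ContinuousLinearMap.id ℝ ℝ) :=
    ((hasFDerivAt_id s).sub_const s).hasMFDerivAt
  rw [← sub_self s] at h1
  have h3 := HasMFDerivAt.comp (I' := 𝓘(ℝ, ℝ)) s (g := fun t => Φ.toFun t (Φ.toFun s p))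
    (f := fun t : ℝ => t - s) h1 h2
  refine h3.congr_of_eventuallyEq ?_
  filter_upwards [(Φ.isOpen_times p).mem_nhds hp] with t ht
  have := Φ.map_add s (t - s) p hp (by rwa [add_sub_cancel])
  rw [add_sub_cancel] at this
  exact this.symm

/-- On the open set J of admissible times the flow agrees with the global curve γ. J is closed: near
a limit time s₀, some t in J has Φ_{s₀-t} defined at γ t, because the flow domain is a neighbourhood
of (0, γ s₀), and the group law puts s₀ in J. -/
theorem LocalOneParamGroup.IsGeneratedBy.source_eq_univ [T2Space M] [IsManifold (𝓡 m) ∞ M]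
    (hΦ : Φ.IsGeneratedBy X) (hX : IsSmoothVecField X) (hc : IsCompleteVecField X) (s : ℝ) :
    (Φ.toFun s).source = univ := by
  refine eq_univ_of_forall fun p => ?_
  obtain ⟨γ, hγ0, hγ⟩ := hc p
  set J := {s : ℝ | p ∈ (Φ.toFun s).source} with hJ
  have hJo : IsOpen J := Φ.isOpen_times p
  have h0 : (0 : ℝ) ∈ J := Φ.zero_mem p
  have hagree : ∀ t ∈ J, Φ.toFun t p = γ t := by
    intro t ht
    -- Uniqueness is applied on an open interval, so the interval between 0 and t is enlarged
    -- slightly inside J.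
    have hmin : min 0 t ∈ J := by rcases min_choice 0 t with h | h <;> rw [h] <;> assumption
    have hmax : max 0 t ∈ J := by rcases max_choice 0 t with h | h <;> rw [h] <;> assumption
    obtain ⟨ε, hε, haJ⟩ := Metric.isOpen_iff.1 hJo _ hmin
    obtain ⟨δ, hδ, hbJ⟩ := Metric.isOpen_iff.1 hJo _ hmax
    have ha : min 0 t - ε / 2 ∈ J := haJ (by
      rw [mem_ball, Real.dist_eq, sub_sub_cancel_left, abs_neg, abs_of_pos (half_pos hε)]
      exact half_lt_self hε)
    have hb : max 0 t + δ / 2 ∈ J := hbJ (by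
      rw [mem_ball, Real.dist_eq, add_sub_cancel_left, abs_of_pos (half_pos hδ)]
      exact half_lt_self hδ)
    have hsub : Ioo (min 0 t - ε / 2) (max 0 t + δ / 2) ⊆ J :=
      Ioo_subset_Icc_self.trans ((Φ.ordConnected p).out ha hb)
    refine isMIntegralCurveOn_Ioo_eqOn_of_contMDiff_boundaryless (I := 𝓡 m) (v := X) (t₀ := 0)
      (γ := fun t => Φ.toFun t p) (γ' := γ) ?_ (ContMDiff.of_le hX (by simp))
      (fun r hr => (hΦ.hasMFDerivAt (hsub hr)).hasMFDerivWithinAt) (hγ.isMIntegralCurveOn _)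
      ((Φ.map_zero p).trans hγ0.symm) ?_
    · exact ⟨by linarith [min_le_left 0 t], by linarith [le_max_left 0 t]⟩
    · exact ⟨by linarith [min_le_right 0 t], by linarith [le_max_right 0 t]⟩
  have hcl : IsClosed J := by
    rw [← closure_subset_iff_isClosed]
    intro s₀ hs₀
    have hD : {z : ℝ × M | z.2 ∈ (Φ.toFun z.1).source} ∈ 𝓝 ((0 : ℝ), γ s₀) :=
      Φ.isOpen_domain.mem_nhds (Φ.zero_mem (γ s₀))
    have ht : Tendsto (fun t => (s₀ - t, γ t)) (𝓝 s₀) (𝓝 ((0 : ℝ), γ s₀)) := by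
      have : Continuous fun t => (s₀ - t, γ t) :=
        (continuous_const.sub continuous_id).prodMk hγ.continuous
      have h := this.tendsto s₀
      rwa [sub_self] at h
    obtain ⟨t, h1, h2⟩ := mem_closure_iff_nhds.1 hs₀ _ (ht hD)
    have h3 : γ t ∈ (Φ.toFun (s₀ - t)).source := h1
    rw [← hagree t h2, Φ.mem_source_iff t _ p h2, add_sub_cancel] at h3
    exact h3
  have hu : J = univ := IsClopen.eq_univ ⟨hcl, hJo⟩ ⟨0, h0⟩
  have hs : s ∈ J := hu ▸ mem_univ s
  exact hs

theorem LocalOneParamGroup.target_eq_univ (Φ : LocalOneParamGroup m M)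
    (h : ∀ s, (Φ.toFun s).source = univ) (s : ℝ) : (Φ.toFun s).target = univ := by
  refine eq_univ_of_forall fun x => ?_
  have h1 := (Φ.neg_mem_source (s := -s) (p := x) (by rw [h]; trivial)).2
  rw [neg_neg] at h1
  rw [← h1]
  exact (Φ.toFun s).map_source (by rw [h]; trivial)

/-- The derivative at time `0` of the pullback of a form by a local flow is its Lie derivative. -/
theorem LocalOneParamGroup.IsGeneratedBy.hasDerivAt_pullback_zero [IsManifold (𝓡 m) ∞ M]
    (hΦ : Φ.IsGeneratedBy X) (hX : IsSmoothVecField X) {k : ℕ} {α : DiffForm m M (k + 1)}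
    (hα : α.IsSmooth) (q : M) (v : Fin (k + 1) → EucSp m) :
    HasDerivAt (fun t => α.pullback (Φ.toFun t) q v) (α.lieDeriv X q v) 0 := by
  set c := extChartAt (𝓡 m) q with hc
  have hq : c.symm (c q) = q := c.left_inv (mem_extChartAt_source q)
  have hto : IsOpen c.target := isOpen_extChartAt_target q
  have ht0 : c q ∈ c.target := mem_extChartAt_target q
  let ψ : ℝ × EucSp m → EucSp m := fun z => c (Φ.toFun z.1 (c.symm z.2))
  have hcs : ContMDiffAt 𝓘(ℝ, EucSp m) (𝓡 m) ∞ c.symm (c q) :=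
    (contMDiffOn_extChartAt_symm q).contMDiffAt (hto.mem_nhds ht0)
  have hin : ContMDiffAt 𝓘(ℝ, ℝ × EucSp m) (𝓘(ℝ, ℝ).prod (𝓡 m)) ∞
      (fun z : ℝ × EucSp m => (z.1, c.symm z.2)) (0, c q) :=
    (contDiff_fst.contMDiff.contMDiffAt).prodMk
      (ContMDiffAt.comp ((0 : ℝ), c q) (g := c.symm) hcs contDiff_snd.contMDiff.contMDiffAt)
  have hΦs : ContMDiffAt (𝓘(ℝ, ℝ).prod (𝓡 m)) (𝓡 m) ∞ (fun z : ℝ × M => Φ.toFun z.1 z.2)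
      ((0 : ℝ), q) := Φ.smooth.contMDiffAt (Φ.isOpen_domain.mem_nhds (Φ.zero_mem q))
  have hψc : ContMDiffAt 𝓘(ℝ, ℝ × EucSp m) (𝓡 m) ∞
      (fun z : ℝ × EucSp m => Φ.toFun z.1 (c.symm z.2)) (0, c q) :=
    ContMDiffAt.comp ((0 : ℝ), c q) (g := fun z : ℝ × M => Φ.toFun z.1 z.2)
      (by simp only [hq]; exact hΦs) hin
  have e0 : Φ.toFun 0 (c.symm (c q)) = q := by rw [hq, Φ.map_zero]
  have hψ : ContDiffAt ℝ 2 ψ (0, c q) := by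
    have h : ContMDiffAt 𝓘(ℝ, ℝ × EucSp m) 𝓘(ℝ, EucSp m) ∞ ψ (0, c q) :=
      ContMDiffAt.comp ((0 : ℝ), c q) (g := c)
        (by simp only [e0]; exact contMDiffAt_extChartAt) hψc
    exact contDiffAt_infty.1 h.contDiffAt 2
  have hY : ∀ᶠ y in 𝓝 (c q), HasDerivAt (fun t => ψ (t, y)) (X.chartRep q y) 0 := by
    filter_upwards [hto.mem_nhds ht0] with y hy
    have hs := c.map_target hy
    have h1 := hΦ.hasMFDerivAt_zero (c.symm y)
    have h2 : MDifferentiableAt (𝓡 m) 𝓘(ℝ, EucSp m) c (c.symm y) :=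
      mdifferentiableAt_extChartAt (by rwa [hc, extChartAt_source] at hs)
    have h3 : HasMFDerivAt (𝓡 m) 𝓘(ℝ, EucSp m) c (Φ.toFun 0 (c.symm y))
        (mfderiv (𝓡 m) 𝓘(ℝ, EucSp m) c (c.symm y) : EucSp m →L[ℝ] EucSp m) := by
      rw [Φ.map_zero]; exact h2.hasMFDerivAt
    have h4 : HasFDerivAt (fun t => ψ (t, y))
        ((1 : ℝ →L[ℝ] ℝ).smulRight (X.chartRep q y)) (0 : ℝ) := by
      refine HasMFDerivAt.hasFDerivAt ((h3.comp (0 : ℝ) h1).congr_mfderiv ?_)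
      refine ContinuousLinearMap.ext_ring ?_
      change mfderiv (𝓡 m) 𝓘(ℝ, EucSp m) c (c.symm y) ((1 : ℝ) • X (c.symm y)) =
        (1 : ℝ) • X.chartRep q y
      rw [one_smul, one_smul]
      rfl
    exact h4.hasDerivAt.congr_deriv (by simp)
  have hψ0 : ∀ᶠ y in 𝓝 (c q), ψ (0, y) = y := by
    filter_upwards [hto.mem_nhds ht0] with y hy
    change c (Φ.toFun 0 (c.symm y)) = y
    rw [Φ.map_zero, c.right_inv hy]
  have hα' : DifferentiableAt ℝ (α.chartRep q) (c q) :=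
    ((hα q).contDiffAt (hto.mem_nhds ht0)).differentiableAt (by simp)
  have hX' : DifferentiableAt ℝ (X.chartRep q) (c q) :=
    ((contDiffOn_chartRep hX q).contDiffAt (hto.mem_nhds ht0)).differentiableAt (by simp)
  have main := hasDerivAt_flow_pullback hψ hY hψ0 hα' v
  rw [← extDeriv_curryLeft_add hα' hX'] at main
  have hval : α.lieDeriv X q v = extDeriv (fun y => (α.chartRep q y).curryLeft (X.chartRep q y))
      (c q) v + extDeriv (α.chartRep q) (c q) (Matrix.vecCons (X.chartRep q (c q)) v) := by
    -- The preferred chart at q has identity derivative at q, so tangent vectors at q are their own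
    -- coordinates.
    have hid : mfderiv (𝓡 m) 𝓘(ℝ, EucSp m) c q = ContinuousLinearMap.id ℝ _ :=
      mfderiv_extChartAt_self
    have e1 : (α.interior X).d q v =
        extDeriv (fun y => (α.chartRep q y).curryLeft (X.chartRep q y)) (c q) v := by
      change extDeriv ((α.interior X).chartRep q) (c q)
        (fun i => (mfderiv (𝓡 m) 𝓘(ℝ, EucSp m) c q (v i) : EucSp m)) = _
      rw [hid]
      refine congrArg (fun L : EucSp m [⋀^Fin (k + 1)]→L[ℝ] ℝ => L v)
        (Filter.EventuallyEq.extDeriv_eq ?_)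
      filter_upwards [hto.mem_nhds ht0] with y hy
      ext u
      change α (c.symm y) (Matrix.vecCons (X (c.symm y) : EucSp m)
          fun i => (mfderiv 𝓘(ℝ, EucSp m) (𝓡 m) c.symm y (u i) : EucSp m)) =
        α (c.symm y) (fun j => (mfderiv 𝓘(ℝ, EucSp m) (𝓡 m) c.symm y
          (Matrix.vecCons (X.chartRep q y) u j) : EucSp m))
      congr 1
      funext j
      refine Fin.cases ?_ (fun j => ?_) j
      · exact (mfderiv_extChartAt_symm_comp q hy (X (c.symm y))).symm
      · rfl
    have e2 : α.d.interior X q v =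
        extDeriv (α.chartRep q) (c q) (Matrix.vecCons (X.chartRep q (c q)) v) := by
      change extDeriv (α.chartRep q) (c q) (fun j => (mfderiv (𝓡 m) 𝓘(ℝ, EucSp m) c q
        (Matrix.vecCons (X q : EucSp m) v j) : EucSp m)) = _
      have eX : X.chartRep q (c q) = X q := by
        refine (congrArg (fun x => (mfderiv (𝓡 m) 𝓘(ℝ, EucSp m) c x (X x) : EucSp m)) hq).trans ?_
        rw [hid]
        rfl
      rw [hid, eX]
      rfl
    rw [← e1, ← e2]
    rfl
  rw [hval]
  refine main.congr_of_eventuallyEq ?_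
  have hmem : ∀ᶠ t in 𝓝 (0 : ℝ), q ∈ (Φ.toFun t).source ∧ Φ.toFun t q ∈ c.source := by
    have hcont : ContinuousAt (fun t => Φ.toFun t q) 0 := (hΦ.hasMFDerivAt_zero q).continuousAt
    refine Filter.Eventually.and ((Φ.isOpen_times q).mem_nhds (Φ.zero_mem q))
      (hcont.eventually ?_)
    simp only [Φ.map_zero]
    exact extChartAt_source_mem_nhds q
  filter_upwards [hmem] with t ht
  have hpt : c.symm (ψ (t, c q)) = Φ.toFun t q := by
    change c.symm (c (Φ.toFun t (c.symm (c q)))) = _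
    rw [hq, c.left_inv ht.2]
  have hcd : MDifferentiableAt (𝓡 m) 𝓘(ℝ, EucSp m) c (Φ.toFun t q) :=
    mdifferentiableAt_extChartAt (by rw [← extChartAt_source (𝓡 m)]; exact ht.2)
  have hΦd : MDifferentiableAt (𝓡 m) (𝓡 m) (Φ.toFun t) q :=
    ((Φ.contMDiffOn t).contMDiffAt ((Φ.toFun t).open_source.mem_nhds ht.1)).mdifferentiableAt
      (by simp)
  have hsd : MDifferentiableAt 𝓘(ℝ, EucSp m) (𝓡 m) c.symm (c q) :=
    mdifferentiableAt_extChartAt_symm' q ht0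
  have hG : HasMFDerivAt 𝓘(ℝ, EucSp m) (𝓡 m) (fun y => Φ.toFun t (c.symm y)) (c q)
      (mfderiv (𝓡 m) (𝓡 m) (Φ.toFun t) q : EucSp m →L[ℝ] EucSp m) := by
    have h1 : HasMFDerivAt (𝓡 m) (𝓡 m) (Φ.toFun t) (c.symm (c q))
        (mfderiv (𝓡 m) (𝓡 m) (Φ.toFun t) q : EucSp m →L[ℝ] EucSp m) := by
      rw [hq]; exact hΦd.hasMFDerivAt
    refine (h1.comp (c q) hsd.hasMFDerivAt).congr_mfderiv ?_
    have h2 : mfderiv 𝓘(ℝ, EucSp m) (𝓡 m) c.symm (c q) = ContinuousLinearMap.id ℝ _ := by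
      have := mfderivWithin_range_extChartAt_symm (I := 𝓡 m) (x := q)
      rwa [ModelWithCorners.range_eq_univ, mfderivWithin_univ] at this
    rw [h2]
    rfl
  have hψd : HasMFDerivAt 𝓘(ℝ, EucSp m) 𝓘(ℝ, EucSp m) (fun y => ψ (t, y)) (c q)
      (fderiv ℝ (fun y => ψ (t, y)) (c q)) := by
    have h1 : MDifferentiableAt 𝓘(ℝ, EucSp m) 𝓘(ℝ, EucSp m) (fun y => ψ (t, y)) (c q) :=
      MDifferentiableAt.comp (I' := 𝓡 m) (g := c) (c q) (by rw [hq]; exact hcd)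
        hG.mdifferentiableAt
    exact h1.differentiableAt.hasFDerivAt.hasMFDerivAt
  have hψs : ψ (t, c q) ∈ c.target := by
    change c (Φ.toFun t (c.symm (c q))) ∈ _
    rw [hq]
    exact c.map_source ht.2
  have hF := (mdifferentiableAt_extChartAt_symm' q hψs).hasMFDerivAt.comp (c q) hψd
  have hev : (fun y => Φ.toFun t (c.symm y)) =ᶠ[𝓝 (c q)] c.symm ∘ fun y => ψ (t, y) := by
    have h1 : ∀ᶠ y in 𝓝 (c q), Φ.toFun t (c.symm y) ∈ c.source := by
      refine hG.continuousAt.eventually ?_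
      simp only [hq]
      exact (isOpen_extChartAt_source q).mem_nhds ht.2
    filter_upwards [h1] with y hy
    exact (c.left_inv hy).symm
  have hvec := hasMFDerivAt_unique hG (hF.congr_of_eventuallyEq hev)
  exact α.apply_congr hpt.symm (funext fun i =>
    congrArg (fun L : EucSp m →L[ℝ] EucSp m => L (v i)) hvec)

end FlowProperties

/-! ### Pullbacks at arbitrary times and eigenforms of the Lie derivative -/

section PullbackByFlow

open Filter Topology

variable {m : ℕ} {M : Type*} [TopologicalSpace M] [ChartedSpace (EucSp m) M]
  {Φ : LocalOneParamGroup m M} {X : VecField m M}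

theorem LocalOneParamGroup.mdifferentiableAt (Φ : LocalOneParamGroup m M) {s : ℝ} {p : M}
    (hp : p ∈ (Φ.toFun s).source) : MDifferentiableAt (𝓡 m) (𝓡 m) (Φ.toFun s) p :=
  ((Φ.contMDiffOn s).contMDiffAt ((Φ.toFun s).open_source.mem_nhds hp)).mdifferentiableAt (by simp)

theorem LocalOneParamGroup.pullback_add (Φ : LocalOneParamGroup m M) {k : ℕ} (α : DiffForm m M k)
    {s t : ℝ} {p : M} (hs : p ∈ (Φ.toFun s).source) (ht : p ∈ (Φ.toFun (s + t)).source)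
    (v : Fin k → EucSp m) :
    α.pullback (Φ.toFun (s + t)) p v = α.pullback (Φ.toFun t) (Φ.toFun s p)
      (fun i => (mfderiv (𝓡 m) (𝓡 m) (Φ.toFun s) p (v i) : EucSp m)) := by
  have hev : Φ.toFun (s + t) =ᶠ[𝓝 p] Φ.toFun t ∘ Φ.toFun s := by
    filter_upwards [(Φ.toFun s).open_source.mem_nhds hs,
      (Φ.toFun (s + t)).open_source.mem_nhds ht] with x h1 h2
    exact (Φ.map_add s t x h1 h2).symm
  have hF := (Φ.mdifferentiableAt ((Φ.mem_source_iff s t p hs).2 ht)).hasMFDerivAt.comp p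
    (Φ.mdifferentiableAt hs).hasMFDerivAt
  have hvec := hasMFDerivAt_unique (Φ.mdifferentiableAt ht).hasMFDerivAt
    (hF.congr_of_eventuallyEq hev)
  exact α.apply_congr (Φ.map_add s t p hs ht).symm (funext fun i =>
    congrArg (fun L : EucSp m →L[ℝ] EucSp m => L (v i)) hvec)

theorem LocalOneParamGroup.pullback_zero (Φ : LocalOneParamGroup m M) {k : ℕ} (α : DiffForm m M k)
    (p : M) (v : Fin k → EucSp m) : α.pullback (Φ.toFun 0) p v = α p v := by
  have hev : Φ.toFun 0 =ᶠ[𝓝 p] id := Eventually.of_forall Φ.map_zero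
  have hvec := hasMFDerivAt_unique (Φ.mdifferentiableAt (Φ.zero_mem p)).hasMFDerivAt
    ((hasMFDerivAt_id p).congr_of_eventuallyEq hev)
  exact α.apply_congr (Φ.map_zero p) (funext fun i =>
    congrArg (fun L : EucSp m →L[ℝ] EucSp m => L (v i)) hvec)

variable [IsManifold (𝓡 m) ∞ M]

/-- Writing Φ_t = Φ_{t-s} ∘ Φ_s near `p` reduces the claim to time 0 at the point Φ_s p. -/
theorem LocalOneParamGroup.IsGeneratedBy.hasDerivAt_pullback (hΦ : Φ.IsGeneratedBy X)
    (hX : IsSmoothVecField X) {k : ℕ} {α : DiffForm m M (k + 1)} (hα : α.IsSmooth) {s : ℝ} {p : M}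
    (hp : p ∈ (Φ.toFun s).source) (v : Fin (k + 1) → EucSp m) :
    HasDerivAt (fun t => α.pullback (Φ.toFun t) p v)
      ((α.lieDeriv X).pullback (Φ.toFun s) p v) s := by
  have h1 := hΦ.hasDerivAt_pullback_zero hX hα (Φ.toFun s p)
    (fun i => (mfderiv (𝓡 m) (𝓡 m) (Φ.toFun s) p (v i) : EucSp m))
  rw [← sub_self s] at h1
  refine (h1.comp_sub_const s s).congr_of_eventuallyEq ?_
  filter_upwards [(Φ.isOpen_times p).mem_nhds hp] with t ht
  have := Φ.pullback_add α (s := s) (t := t - s) hp (by rwa [add_sub_cancel]) v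
  rwa [add_sub_cancel] at this

/-- The pullback by the flow of `X` of an eigenform of the Lie derivative along `X`. -/
theorem LocalOneParamGroup.IsGeneratedBy.pullback_eq_exp_smul (hΦ : Φ.IsGeneratedBy X)
    (hX : IsSmoothVecField X) {k : ℕ} {α : DiffForm m M (k + 1)} (hα : α.IsSmooth) {c : ℝ}
    (hc : α.lieDeriv X = c • α) {s : ℝ} {p : M} (hp : p ∈ (Φ.toFun s).source)
    (v : Fin (k + 1) → EucSp m) :
    α.pullback (Φ.toFun s) p v = Real.exp (c * s) * α p v := by
  -- The integrating factor e^{-ct} turns the linear equation for the pullback into constancy.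
  have hd : ∀ t ∈ {t : ℝ | p ∈ (Φ.toFun t).source},
      HasDerivAt (fun t => Real.exp (-(c * t)) * α.pullback (Φ.toFun t) p v) 0 t := by
    intro t ht
    have h1 := hΦ.hasDerivAt_pullback hX hα ht v
    have h2 : HasDerivAt (fun t => Real.exp (-(c * t))) (Real.exp (-(c * t)) * (-(c * 1))) t :=
      (((hasDerivAt_id t).const_mul c).neg).exp
    refine (h2.mul h1).congr_deriv ?_
    have h3 : (α.lieDeriv X).pullback (Φ.toFun t) p v = c * α.pullback (Φ.toFun t) p v := by
      rw [hc]; rfl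
    rw [h3]
    ring
  have hconst := (Φ.isOpen_times p).is_const_of_deriv_eq_zero
    (Φ.ordConnected p).isPreconnected
    (fun t ht => (hd t ht).differentiableAt.differentiableWithinAt)
    (fun t ht => (hd t ht).deriv) hp (Φ.zero_mem p)
  simp only [mul_zero, neg_zero, Real.exp_zero, one_mul, Φ.pullback_zero] at hconst
  rw [← hconst, ← mul_assoc, ← Real.exp_add, add_neg_cancel, Real.exp_zero, one_mul]

end PullbackByFlow

/-! ### Flows of scaling symmetries are canonoid and not canonical -/

section ScalingSymmetry

variable {n : ℕ} {M : Type*} [TopologicalSpace M] [ChartedSpace (EucSp (2 * n)) M]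
  [IsManifold (𝓡 (2 * n)) ∞ M] {S : LCSStructure n M} {H : M → ℝ} {Λ : ℝ}
  {X : VecField (2 * n) M} {Φ : LocalOneParamGroup (2 * n) M}

theorem LCSStructure.IsScalingSymmetry.pullback_Ω (hX : S.IsScalingSymmetry H Λ X)
    (hΦ : Φ.IsGeneratedBy X) {s : ℝ} {p : M} (hp : p ∈ (Φ.toFun s).source)
    (v : Fin 2 → EucSp (2 * n)) :
    S.Ω.pullback (Φ.toFun s) p v = Real.exp s * S.Ω p v := by
  have h := hΦ.pullback_eq_exp_smul hX.smooth S.smooth_Ω (c := 1)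
    (by rw [one_smul]; exact hX.lie_Ω) hp v
  rwa [one_mul] at h

theorem LCSStructure.IsScalingSymmetry.pullback_θ (hX : S.IsScalingSymmetry H Λ X)
    (hΦ : Φ.IsGeneratedBy X) {s : ℝ} {p : M} (hp : p ∈ (Φ.toFun s).source)
    (v : Fin 1 → EucSp (2 * n)) :
    S.θ.pullback (Φ.toFun s) p v = S.θ p v := by
  have h := hΦ.pullback_eq_exp_smul hX.smooth S.smooth_θ (c := 0)
    (by rw [zero_smul]; exact hX.lie_θ) hp v
  rwa [zero_mul, Real.exp_zero, one_mul] at h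

theorem LCSStructure.IsScalingSymmetry.isCanonoid (hX : S.IsScalingSymmetry H Λ X)
    (hH : ContMDiff (𝓡 (2 * n)) 𝓘(ℝ, ℝ) ∞ H) (hΦ : Φ.IsGeneratedBy X) (s : ℝ) :
    S.IsCanonoid H (Φ.toFun s) := by
  -- The witness is K = e^s H: the factor e^s from Φ_s^*Ω moves inside d^θ, and Φ_s^*θ = θ.
  have hK : ContMDiff (𝓡 (2 * n)) 𝓘(ℝ, ℝ) ∞ (Real.exp s • H) :=
    (contDiff_const.mul contDiff_id : ContDiff ℝ ∞ fun r : ℝ => Real.exp s * r).contMDiff.comp hH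
  refine ⟨Φ.isTransformation s, Real.exp s • H, hK.contMDiffOn, fun p hp v => ?_⟩
  have h1 : diffFun (2 * n) (Real.exp s • H) p v = Real.exp s * diffFun (2 * n) H p v := by
    have hd : MDifferentiableAt (𝓡 (2 * n)) 𝓘(ℝ, ℝ) H p := hH.mdifferentiableAt (by simp)
    have := (hd.hasMFDerivAt.const_smul (Real.exp s)).mfderiv
    exact congrArg (fun L : EucSp (2 * n) →L[ℝ] ℝ => L v) this
  have h2 := hX.pullback_θ hΦ hp ![v]
  change S.Ω.pullback (Φ.toFun s) p ![S.hamVF H p, v] =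
    diffFun (2 * n) (Real.exp s • H) p v - (Real.exp s * H p) * S.θ.pullback (Φ.toFun s) p ![v]
  rw [h1]
  have h3 := (hX.pullback_Ω hΦ hp ![S.hamVF H p, v]).trans
    (congrArg (Real.exp s * ·) (S.hamVF_spec H p v))
  refine h3.trans ?_
  refine Eq.trans ?_ (congrArg (fun r => Real.exp s * diffFun (2 * n) H p v -
    (Real.exp s * H p) * r) h2.symm)
  have hring : ∀ a b c d : ℝ, a * (b - c * d) = a * b - a * c * d := fun a b c d => by ring
  exact hring _ _ _ _

theorem LCSStructure.IsScalingSymmetry.not_isCanonical (hn : 0 < n)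
    (hX : S.IsScalingSymmetry H Λ X) (hΦ : Φ.IsGeneratedBy X) {s : ℝ} (hs : s ≠ 0)
    (hne : (Φ.toFun s).source.Nonempty) : ¬ S.IsCanonical (Φ.toFun s) := by
  rintro ⟨-, hcan⟩
  obtain ⟨p, hp⟩ := hne
  have hexp : Real.exp s ≠ 1 := by rwa [Ne, Real.exp_eq_one_iff]
  have hzero : ∀ u v : EucSp (2 * n), S.Ω p ![u, v] = 0 := by
    intro u v
    have h1 := hX.pullback_Ω hΦ hp ![u, v]
    have h2 : S.Ω.pullback (Φ.toFun s) p ![u, v] = S.Ω p ![u, v] :=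
      congrArg (fun β : EucSp (2 * n) [⋀^Fin 2]→L[ℝ] ℝ => β ![u, v]) (hcan p hp)
    by_contra h
    exact hexp (mul_right_cancel₀ h ((h2.symm.trans h1).symm.trans (one_mul _).symm))
  have hall : ∀ u : EucSp (2 * n), u = 0 := fun u => S.nondegenerate p u (hzero u)
  -- Since 2n > 0 there is a nonzero basis vector, while a vanishing nondegenerate form leaves only
  -- 0.
  have h1 : (EuclideanSpace.single (⟨0, by omega⟩ : Fin (2 * n)) (1 : ℝ)) = 0 := hall _
  simp at h1

end ScalingSymmetry

end

theorem mainTheorem5 (n : ℕ) (hn : 0 < n) (M : Type*) [TopologicalSpace M] [T2Space M]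
    [ChartedSpace (EucSp (2 * n)) M] [IsManifold (𝓡 (2 * n)) ∞ M]
    (S : LCSStructure n M) (H : M → ℝ) (hH : ContMDiff (𝓡 (2 * n)) 𝓘(ℝ, ℝ) ∞ H)
    (Λ : ℝ) (X : VecField (2 * n) M) (hX : S.IsScalingSymmetry H Λ X) :
    (∃ Φ : LocalOneParamGroup (2 * n) M, Φ.IsGeneratedBy X) ∧
    ∀ Φ : LocalOneParamGroup (2 * n) M, Φ.IsGeneratedBy X →
      (∀ s : ℝ, S.IsCanonoid H (Φ.toFun s)) ∧
      (∀ s : ℝ, s ≠ 0 → (Φ.toFun s).source.Nonempty → ¬ S.IsCanonical (Φ.toFun s)) ∧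
      (IsCompleteVecField X →
        ∀ s : ℝ, (Φ.toFun s).source = univ ∧ (Φ.toFun s).target = univ) := by
  refine ⟨exists_localOneParamGroup hX.smooth, fun Φ hΦ => ⟨hX.isCanonoid hH hΦ,
    fun s hs hne => hX.not_isCanonical hn hΦ hs hne, fun hc s => ?_⟩⟩
  have hsrc := hΦ.source_eq_univ hX.smooth hc
  exact ⟨hsrc s, Φ.target_eq_univ hsrc s⟩
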